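/- Let $H$ be a separable real Hilbert space with inner product $(\cdot,\cdot)$ and norm $\|\cdot\|$, and let $A\colon D(A)\subset H\to H$ be a densely defined, self-adjoint, positive definite (not necessarily bounded) linear operator with compact inverse. Let $(e_i)$ be an orthonormal basis of $H$ consisting of eigenvectors of $A$, with eigenvalues $\lambda_i>0$. For $r\in\mathbb R$ let $\dot H^r$ be the space of formal series $x=\sum_i x_ie_i$, $x_i\in\mathbb R$, with $\|x\|_r^2:=\sum_i\lambda_i^r x_i^2<\infty$ (so that $\dot H^0=H$), let $a(x,y)=(A^{1/2}x,A^{1/2}y)=\sum_i\lambda_ix_iy_i$ for $x,y\in\dot H^1$, and let $E(t)=\mathrm e^{-At}$, that is, $E(t)x=\sum_i \mathrm e^{-\lambda_it}x_ie_i$; for $t>0$ this defines an element of $H$ for every $x\in\dot H^r$. Let $(S_h)_{h\in(0,1]}$ be a family of finite dimensional subspaces of $\dot H^1$. The Ritz projector $R_h\colon\dot H^1\to S_h$, the operator $A_h\colon S_h\to S_h$ and the generalized orthogonal projector $P_h\colon\dot H^{-1}\to S_h$ are defined by $$a(R_hx,y_h)=a(x,y_h),\qquad (A_hx_h,y_h)=a(x_h,y_h),\qquad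 (P_hx,y_h)=a(A^{-1}x,y_h)\qquad\text{for all } y_h\in S_h.$$ Assume the approximation property: there is a constant $C_0$ with $$\|R_hx-x\|\le C_0h^s\|x\|_s\qquad\text{for all }x\in\dot H^s,\ s\in\{1,2\},\ h\in(0,1].$$ For a time step $k\in(0,1]$ put $t_j=jk$, let $R(z)=\frac1{1+z}$, define $R(kA_h)$ by spectral calculus for the symmetric operator $A_h$ (so $R(kA_h)=(I+kA_h)^{-1}$), let $E_{kh}(t)=R(kA_h)^j$ for $t\in[t_{j-1},t_j)$, $j=1,2,\dots$, and let $F_{kh}(t)=E_{kh}(t)P_h-E(t)$. Then the following hold. (i) Let $0\le\nu\le\mu\le2$. There exists a constant $C$ such that $$\|F_{kh}(t)x\|\le C\big(h^\mu+k^{\mu/2}\big)t^{-(\mu-\nu)/2}\|x\|_\nu\qquad\text{for all }x\in\dot H^\nu,\ t>0,\ h,k\in(0,1].$$ (ii) Let $0\le\rho\le1$. There exists a constant $C$ such that $$\|F_{kh}(t)x\|\le Ct^{-\rho/2}\|x\|_{-\rho}\qquad\text{for all }x\in\dot H^{-\rho},\ t>0,\ h,k\in(0,1].$$ (iii) Let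 $0\le\rho\le1$. There exists a constant $C$ such that $$\|F_{kh}(t)x\|\le C\big(h^{2-\rho}+k^{(2-\rho)/2}\big)t^{-1}\|x\|_{-\rho}\qquad\text{for all }x\in\dot H^{-\rho},\ t>0,\ h,k\in(0,1].$$ -/

import Mathlib

open scoped InnerProductSpace

noncomputable section

universe u

namespace Galerkin

/-- A linear operator `A : D(A) ⊂ H → H` on a real Hilbert space which is densely defined,
self-adjoint, positive definite, not necessarily bounded, and has a compact inverse. -/
structure EllipticOperator (H : Type*) [NormedAddCommGroup H] [InnerProductSpace ℝ H]
    [CompleteSpace H] where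
  op : H →ₗ.[ℝ] H
  dense : Dense (op.domain : Set H)
  selfAdjoint : IsSelfAdjoint op
  pos : ∀ x : op.domain, x ≠ 0 → 0 < ⟪op x, (x : H)⟫_ℝ
  compact_inverse : ∃ K : H →L[ℝ] H, IsCompactOperator K ∧
    (∀ y : H, ∃ hy : K y ∈ op.domain, op ⟨K y, hy⟩ = y) ∧
    (∀ x : op.domain, K (op x) = x)

/-- An orthonormal (Hilbert) basis of `H` consisting of eigenvectors of `A`, with the
corresponding eigenvalues. (The index type is arbitrary; `ι = ℕ` with increasing
eigenvalues is a special case.) -/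
structure Eigensystem {H : Type*} [NormedAddCommGroup H] [InnerProductSpace ℝ H]
    [CompleteSpace H] (A : EllipticOperator H) (ι : Type*) where
  e : HilbertBasis ι ℝ H
  lam : ι → ℝ
  mem_domain : ∀ i, e i ∈ A.op.domain
  eigen : ∀ i, A.op ⟨e i, mem_domain i⟩ = lam i • e i

section

variable {H : Type*} [NormedAddCommGroup H] [InnerProductSpace ℝ H] [CompleteSpace H]
  {A : EllipticOperator H} {ι : Type*}

/-- Every operator as above possesses an eigensystem. -/
theorem EllipticOperator.exists_eigensystem {H : Type u} [NormedAddCommGroup H]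
    [InnerProductSpace ℝ H] [CompleteSpace H] (A : EllipticOperator H) :
    ∃ ι : Type u, Nonempty (Eigensystem A ι) := by
  obtain ⟨K, hK, h1, h2⟩ := A.compact_inverse
  have hsym : ∀ x y : A.op.domain, ⟪A.op x, (y : H)⟫_ℝ = ⟪(x : H), A.op y⟫_ℝ := by
    have h := LinearPMap.adjoint_isFormalAdjoint (T := A.op) A.dense
    rw [(LinearPMap.isSelfAdjoint_def).1 A.selfAdjoint] at h
    intro x y
    exact h x y
  have hKs : (K : H →ₗ[ℝ] H).IsSymmetric := by
    intro x y
    obtain ⟨hx, hx'⟩ := h1 x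
    obtain ⟨hy, hy'⟩ := h1 y
    have := hsym ⟨K x, hx⟩ ⟨K y, hy⟩
    rw [hx', hy'] at this
    exact this.symm
  have hbot := ContinuousLinearMap.orthogonalComplement_iSup_eigenspaces_eq_bot hK hKs
  have horth := hKs.orthogonalFamily_eigenspaces
  have hcl : ∀ μ : ℝ, CompleteSpace (Module.End.eigenspace (K : H →ₗ[ℝ] H) μ) := by
    intro μ
    have : IsClosed ((Module.End.eigenspace (K : H →ₗ[ℝ] H) μ : Submodule ℝ H) : Set H) := by
      have : ((Module.End.eigenspace (K : H →ₗ[ℝ] H) μ : Submodule ℝ H) : Set H)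
          = {x | K x = μ • x} := by
        ext x
        simp
      rw [this]
      exact isClosed_eq K.continuous (continuous_const_smul μ)
    exact this.completeSpace_coe
  have hb := fun μ : ℝ => exists_hilbertBasis ℝ (Module.End.eigenspace (K : H →ₗ[ℝ] H) μ)
  choose w b hwb using hb
  have hon := horth.orthonormal_sigma_orthonormal
    (v_family := fun μ => (b μ : w μ → _)) (fun μ => (b μ).orthonormal)
  have hspan : (Submodule.span ℝ (Set.range
      (fun a : Σ μ, w μ => ((b a.1 a.2 : Module.End.eigenspace (K : H →ₗ[ℝ] H) a.1) : H))))ᗮ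
      = ⊥ := by
    rw [eq_bot_iff, ← hbot, ← Submodule.iInf_orthogonal]
    intro x hx
    rw [Submodule.mem_iInf]
    intro μ
    rw [Submodule.mem_orthogonal']
    intro u hu
    have hs := (b μ).hasSum_repr ⟨u, hu⟩
    have hs' := (hs.mapL (Module.End.eigenspace (K : H →ₗ[ℝ] H) μ).subtypeL).mapL (innerSL ℝ x)
    have hz : ∀ i, innerSL ℝ x ((Module.End.eigenspace (K : H →ₗ[ℝ] H) μ).subtypeL
        ((b μ).repr ⟨u, hu⟩ i • (b μ) i)) = 0 := by
      intro i
      have := (Submodule.mem_orthogonal' _ _).1 hx _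
        (Submodule.subset_span (Set.mem_range_self (⟨μ, i⟩ : Σ μ, w μ)))
      simp only [map_smul, Submodule.subtypeL_apply, innerSL_apply_apply]
      rw [this, smul_zero]
    simp only [hz] at hs'
    have := hs'.unique hasSum_zero
    simpa using this
  let B := HilbertBasis.mkOfOrthogonalEqBot hon hspan
  have hB : ∀ a : Σ μ, w μ, K (B a) = a.1 • B a := by
    intro a
    have : B a = ((b a.1 a.2 : Module.End.eigenspace (K : H →ₗ[ℝ] H) a.1) : H) := by
      simp [B]
    rw [this]
    exact Module.End.mem_eigenspace_iff.1 (b a.1 a.2).2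
  have hne : ∀ a : Σ μ, w μ, a.1 ≠ 0 := by
    intro a h0
    have hk : K (B a) = 0 := by rw [hB, h0, zero_smul]
    obtain ⟨hy, hy'⟩ := h1 (B a)
    have h3 : A.op ⟨K (B a), hy⟩ = 0 := by
      have : (⟨K (B a), hy⟩ : A.op.domain) = 0 := Subtype.ext hk
      rw [this, LinearPMap.map_zero]
    have : B a = 0 := by rw [← hy', h3]
    have hn := B.orthonormal.1 a
    rw [this, norm_zero] at hn
    exact zero_ne_one hn
  have hBK : ∀ a : Σ μ, w μ, B a = (a.1)⁻¹ • K (B a) := by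
    intro a
    rw [hB, smul_smul, inv_mul_cancel₀ (hne a), one_smul]
  have hdom : ∀ a : Σ μ, w μ, B a ∈ A.op.domain := by
    intro a
    rw [hBK]
    exact A.op.domain.smul_mem _ (h1 (B a)).1
  refine ⟨Σ μ, w μ, ⟨{ e := B, lam := fun a => (a.1)⁻¹, mem_domain := hdom, eigen := fun a => ?_ }⟩⟩
  obtain ⟨hy, hy'⟩ := h1 (B a)
  have h3 : (⟨B a, hdom a⟩ : A.op.domain) = (a.1)⁻¹ • ⟨K (B a), hy⟩ := Subtype.ext (hBK a)
  rw [h3, LinearPMap.map_smul, hy']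

namespace Eigensystem

variable (E : Eigensystem A ι)

theorem lam_pos (i : ι) : 0 < E.lam i := by
  have hn := E.e.orthonormal.1 i
  have hne : (⟨E.e i, E.mem_domain i⟩ : A.op.domain) ≠ 0 := by
    intro h
    have : E.e i = 0 := congrArg Subtype.val h
    rw [this, norm_zero] at hn
    exact zero_ne_one hn
  have := A.pos _ hne
  rw [E.eigen i, real_inner_smul_left, real_inner_self_eq_norm_sq, hn] at this
  simpa using this

/-- The eigenvalues are bounded away from zero. -/
theorem exists_lower_bound : ∃ c : ℝ, 0 < c ∧ ∀ i, c ≤ E.lam i := by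
  obtain ⟨K, -, -, h2⟩ := A.compact_inverse
  refine ⟨(‖K‖ + 1)⁻¹, by positivity, fun i => ?_⟩
  have hn := E.e.orthonormal.1 i
  have hl := E.lam_pos i
  have h := h2 ⟨E.e i, E.mem_domain i⟩
  rw [E.eigen i, map_smul] at h
  have h' : E.lam i * ‖K (E.e i)‖ = 1 := by
    rw [← abs_of_pos hl, ← Real.norm_eq_abs, ← norm_smul, h]
    exact hn
  have hb : ‖K (E.e i)‖ ≤ ‖K‖ := by simpa [hn] using K.le_opNorm (E.e i)
  rw [inv_le_iff_one_le_mul₀ (by positivity)]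
  nlinarith

/-- The space `Ḣ^r`, `r ∈ ℝ`. Its elements are the formal series `∑ xᵢ eᵢ` with
`∑ λᵢ^r xᵢ² < ∞`, represented by their families of coefficients `x : ι → ℝ`. -/
def Hdot (r : ℝ) : Submodule ℝ (ι → ℝ) where
  carrier := {x | Summable fun i => E.lam i ^ r * x i ^ 2}
  zero_mem' := by simp [summable_zero]
  add_mem' := by
    intro x y hx hy
    refine Summable.of_nonneg_of_le (fun i => ?_) (fun i => ?_)
      ((Summable.mul_left 2 hx).add (Summable.mul_left 2 hy))
    · have := Real.rpow_nonneg (E.lam_pos i).le r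
      positivity
    · have := Real.rpow_nonneg (E.lam_pos i).le r
      simp only [Pi.add_apply]
      nlinarith [mul_nonneg this (sq_nonneg (x i - y i))]
  smul_mem' := by
    intro c x hx
    refine (Summable.mul_left (c ^ 2) hx).congr fun i => ?_
    simp only [Pi.smul_apply, smul_eq_mul]
    ring

/-- The norm `‖x‖_r = (∑ λᵢ^r xᵢ²)^{1/2}` of `Ḣ^r`. -/
def hnorm (r : ℝ) (x : ι → ℝ) : ℝ := √(∑' i, E.lam i ^ r * x i ^ 2)

/-- The coefficients `(x, eᵢ)` of a vector `x ∈ H`. -/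
def coeff (x : H) : ι → ℝ := fun i => ⟪E.e i, x⟫_ℝ

/-- The vector `∑ xᵢ eᵢ` of `H` with given square summable coefficients. -/
def toH (x : ι → ℝ) : H := ∑' i, x i • E.e i

/-- The form `a(x, y) = (A^{1/2} x, A^{1/2} y)` on `Ḣ^1`. -/
def form (x y : ι → ℝ) : ℝ := ∑' i, E.lam i * x i * y i

/-- The duality pairing `⟨x, y⟩ = a(A⁻¹ x, y)` between `Ḣ^{-1}` and `Ḣ^1`. -/
def pairing (x y : ι → ℝ) : ℝ := E.form (fun i => (E.lam i)⁻¹ * x i) y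

/-- The semigroup `E(t) = e^{-At}`, applied to `x ∈ Ḣ^r`: the vector
`∑ e^{-λᵢ t} xᵢ eᵢ` of `H`. -/
def semigroup (t : ℝ) (x : ι → ℝ) : H := E.toH fun i => Real.exp (-(E.lam i * t)) * x i

theorem hasSum_toH {x : ι → ℝ} (hx : x ∈ E.Hdot 0) :
    HasSum (fun i => x i • E.e i) (E.toH x) := by
  have hx' : Summable fun i => x i ^ 2 := by
    simpa [Hdot, Real.rpow_zero] using hx
  refine Summable.hasSum ?_
  have hm : Memℓp x 2 := by
    refine memℓp_gen ?_
    simpa using hx'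
  exact (E.e.hasSum_repr_symm ⟨x, hm⟩).summable

/-- The coefficients of a vector of `H` are square summable, and it is their sum. -/
theorem coeff_mem (x : H) : E.coeff x ∈ E.Hdot 0 := by
  have h := (E.e.repr x).2
  have h2 := (memℓp_gen_iff (by norm_num)).1 h
  have : Summable fun i => (E.coeff x i) ^ 2 := by
    simpa [coeff, HilbertBasis.repr_apply_apply] using h2
  simpa [Hdot, Real.rpow_zero] using this

theorem toH_coeff (x : H) : E.toH (E.coeff x) = x := by
  refine (E.hasSum_toH (E.coeff_mem x)).unique ?_
  simpa [coeff, HilbertBasis.repr_apply_apply] using E.e.hasSum_repr x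

theorem Hdot_antitone {r s : ℝ} (h : r ≤ s) : E.Hdot s ≤ E.Hdot r := by
  obtain ⟨c, hc, hl⟩ := E.exists_lower_bound
  intro x hx
  refine Summable.of_nonneg_of_le (fun i => ?_) (fun i => ?_)
      (Summable.mul_left (c ^ (r - s)) hx)
  · have := Real.rpow_nonneg (E.lam_pos i).le r
    positivity
  · have h1 : E.lam i ^ r = E.lam i ^ (r - s) * E.lam i ^ s := by
      rw [← Real.rpow_add (E.lam_pos i)]
      congr 1
      ring
    have h2 : E.lam i ^ (r - s) ≤ c ^ (r - s) :=
      Real.rpow_le_rpow_of_nonpos hc (hl i) (by linarith)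
    have h3 := Real.rpow_nonneg (E.lam_pos i).le s
    rw [h1, mul_assoc]
    exact mul_le_mul_of_nonneg_right h2 (by positivity)

/-- For `t > 0` the series defining `E(t) x` converges in `H` for every `x ∈ Ḣ^r`. -/
theorem hasSum_semigroup {t r : ℝ} (ht : 0 < t) {x : ι → ℝ} (hx : x ∈ E.Hdot r) :
    HasSum (fun i => (Real.exp (-(E.lam i * t)) * x i) • E.e i) (E.semigroup t x) := by
  refine E.hasSum_toH ?_
  wlog hr : r ≤ 0 generalizing r
  · exact this (r := 0) (E.Hdot_antitone (le_of_not_ge hr) hx) le_rfl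
  obtain ⟨M, hM⟩ : ∃ M : ℝ, ∀ l : ℝ, 0 < l → l ^ (-r) * Real.exp (-(l * t)) ^ 2 ≤ M := by
    have h1 := tendsto_rpow_mul_exp_neg_mul_atTop_nhds_zero (-r) (2 * t) (by positivity)
    obtain ⟨N, hN⟩ := Filter.eventually_atTop.1 (h1.eventually (gt_mem_nhds zero_lt_one))
    refine ⟨max 1 (N ^ (-r)), fun l hl => ?_⟩
    have he : Real.exp (-(l * t)) ^ 2 = Real.exp (-(2 * t) * l) := by
      rw [← Real.exp_nat_mul]
      congr 1
      push_cast
      ring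
    rw [he]
    by_cases h : N ≤ l
    · exact (hN l h).le.trans (le_max_left _ _)
    · refine le_trans ?_ (le_max_right _ _)
      have h2 : l ^ (-r) ≤ N ^ (-r) := Real.rpow_le_rpow hl.le (le_of_not_ge h) (by linarith)
      have h3 : Real.exp (-(2 * t) * l) ≤ 1 := Real.exp_le_one_iff.2 (by nlinarith)
      calc _ ≤ l ^ (-r) * 1 := mul_le_mul_of_nonneg_left h3 (Real.rpow_nonneg hl.le _)
        _ ≤ _ := by simpa using h2
  refine Summable.of_nonneg_of_le (fun i => ?_) (fun i => ?_) (Summable.mul_left M hx)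
  · have := Real.rpow_nonneg (E.lam_pos i).le 0
    positivity
  · have h1 := hM _ (E.lam_pos i)
    have h2 := Real.rpow_nonneg (E.lam_pos i).le r
    have h3 : E.lam i ^ (-r) * E.lam i ^ r = 1 := by
      rw [← Real.rpow_add (E.lam_pos i)]
      simp
    rw [Real.rpow_zero, one_mul, mul_pow]
    calc Real.exp (-(E.lam i * t)) ^ 2 * x i ^ 2
        = (E.lam i ^ (-r) * Real.exp (-(E.lam i * t)) ^ 2) * (E.lam i ^ r * x i ^ 2) := by
          linear_combination (-(Real.exp (-(E.lam i * t)) ^ 2 * x i ^ 2)) * h3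
      _ ≤ _ := mul_le_mul_of_nonneg_right h1 (by positivity)

theorem summable_form {x y : ι → ℝ} (hx : x ∈ E.Hdot 1) (hy : y ∈ E.Hdot 1) :
    Summable fun i => E.lam i * x i * y i := by
  have hx' : Summable fun i => E.lam i ^ (1 : ℝ) * x i ^ 2 := hx
  have hy' : Summable fun i => E.lam i ^ (1 : ℝ) * y i ^ 2 := hy
  simp only [Real.rpow_one] at hx' hy'
  refine Summable.of_norm_bounded (hx'.add hy') fun i => ?_
  have := E.lam_pos i
  rw [Real.norm_eq_abs, abs_le]
  constructor <;>
  nlinarith [mul_nonneg this.le (sq_nonneg (x i + y i)),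
    mul_nonneg this.le (sq_nonneg (x i - y i)), mul_nonneg this.le (sq_nonneg (x i)),
    mul_nonneg this.le (sq_nonneg (y i))]

theorem form_comm (x y : ι → ℝ) : E.form x y = E.form y x :=
  tsum_congr fun i => by ring

theorem form_add {x y z : ι → ℝ} (hx : x ∈ E.Hdot 1) (hy : y ∈ E.Hdot 1)
    (hz : z ∈ E.Hdot 1) : E.form x (y + z) = E.form x y + E.form x z := by
  rw [form, form, form, ← (E.summable_form hx hy).tsum_add (E.summable_form hx hz)]
  exact tsum_congr fun i => by simp only [Pi.add_apply]; ring

theorem form_smul (c : ℝ) (x y : ι → ℝ) : E.form x (c • y) = c * E.form x y := by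
  rw [form, form, ← tsum_mul_left]
  exact tsum_congr fun i => by simp only [Pi.smul_apply, smul_eq_mul]; ring

theorem inv_mul_mem {x : ι → ℝ} (hx : x ∈ E.Hdot (-1)) :
    (fun i => (E.lam i)⁻¹ * x i) ∈ E.Hdot 1 := by
  refine Summable.congr hx fun i => ?_
  have := (E.lam_pos i).ne'
  rw [Real.rpow_neg_one, Real.rpow_one]
  field_simp

theorem pairing_eq (x y : ι → ℝ) : E.pairing x y = ∑' i, x i * y i :=
  tsum_congr fun i => by
    have := (E.lam_pos i).ne'
    field_simp

theorem coeff_add (x y : H) : E.coeff (x + y) = E.coeff x + E.coeff y := by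
  ext i; simp [coeff, inner_add_right]

theorem coeff_smul (c : ℝ) (x : H) : E.coeff (c • x) = c • E.coeff x := by
  ext i; simp [coeff, inner_smul_right]

end Eigensystem

/-- A finite dimensional subspace `S` of `H` with `S ⊂ Ḣ^1`. -/
structure GalerkinSpace (E : Eigensystem A ι) where
  S : Submodule ℝ H
  finiteDimensional : FiniteDimensional ℝ S
  coeff_mem : ∀ y : S, E.coeff y ∈ E.Hdot 1

namespace GalerkinSpace

variable {E : Eigensystem A ι} (V : GalerkinSpace E)

instance : FiniteDimensional ℝ V.S := V.finiteDimensional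

/-- The element of `S` representing a linear functional on `S` with respect to the inner
product of `H`. -/
def riesz (f : V.S → ℝ) : V.S :=
  ∑ m, f (stdOrthonormalBasis ℝ V.S m) • stdOrthonormalBasis ℝ V.S m

theorem riesz_spec {f : V.S → ℝ} (hadd : ∀ y z, f (y + z) = f y + f z)
    (hsmul : ∀ (c : ℝ) y, f (c • y) = c * f y) (y : V.S) : ⟪V.riesz f, y⟫_ℝ = f y := by
  let g : V.S →ₗ[ℝ] ℝ := { toFun := f, map_add' := hadd, map_smul' := hsmul }
  have h : f y = g (∑ m, ⟪stdOrthonormalBasis ℝ V.S m, y⟫_ℝ • stdOrthonormalBasis ℝ V.S m) := by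
    rw [(stdOrthonormalBasis ℝ V.S).sum_repr']
    rfl
  rw [h, map_sum, riesz, sum_inner]
  refine Finset.sum_congr rfl fun m _ => ?_
  rw [map_smul, real_inner_smul_left, smul_eq_mul, mul_comm]
  rfl

/-- The discrete operator `A_h : S → S`, `(A_h x, y) = a(x, y)` for all `y ∈ S`. -/
def discOp : V.S →ₗ[ℝ] V.S where
  toFun x := V.riesz fun y => E.form (E.coeff x) (E.coeff y)
  map_add' x y := by
    simp only [riesz, ← Finset.sum_add_distrib, ← add_smul]
    refine Finset.sum_congr rfl fun m _ => ?_
    rw [E.form_comm, Submodule.coe_add, E.coeff_add,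
      E.form_add (V.coeff_mem _) (V.coeff_mem _) (V.coeff_mem _), E.form_comm,
      E.form_comm _ (E.coeff y)]
  map_smul' c x := by
    simp only [riesz, Finset.smul_sum, smul_smul, RingHom.id_apply]
    refine Finset.sum_congr rfl fun m _ => ?_
    rw [E.form_comm, Submodule.coe_smul, E.coeff_smul, E.form_smul, E.form_comm]

theorem inner_riesz_form {x : ι → ℝ} (hx : x ∈ E.Hdot 1) (y : V.S) :
    ⟪V.riesz fun y => E.form x (E.coeff y), y⟫_ℝ = E.form x (E.coeff y) := by
  refine V.riesz_spec (fun y z => ?_) (fun c y => ?_) y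
  · rw [Submodule.coe_add, E.coeff_add, E.form_add hx (V.coeff_mem _) (V.coeff_mem _)]
  · rw [Submodule.coe_smul, E.coeff_smul, E.form_smul]

theorem discOp_spec (x y : V.S) : ⟪V.discOp x, y⟫_ℝ = E.form (E.coeff x) (E.coeff y) :=
  V.inner_riesz_form (V.coeff_mem x) y

theorem discOp_symmetric : V.discOp.IsSymmetric := by
  intro x y
  rw [V.discOp_spec, real_inner_comm, V.discOp_spec, E.form_comm]

/-- The eigenvalues of `A_h`. -/
def eigval (m : Fin (Module.finrank ℝ V.S)) : ℝ := V.discOp_symmetric.eigenvalues rfl m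

/-- An orthonormal basis of `S` of eigenvectors of `A_h` belonging to `eigval`. -/
def eigvec : OrthonormalBasis (Fin (Module.finrank ℝ V.S)) ℝ V.S :=
  V.discOp_symmetric.eigenvectorBasis rfl

theorem discOp_eigvec (m : Fin (Module.finrank ℝ V.S)) :
    V.discOp (V.eigvec m) = V.eigval m • V.eigvec m :=
  V.discOp_symmetric.apply_eigenvectorBasis rfl m

theorem eigval_pos (m : Fin (Module.finrank ℝ V.S)) : 0 < V.eigval m := by
  have h1 : V.eigval m = E.form (E.coeff (V.eigvec m : H)) (E.coeff (V.eigvec m : H)) := by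
    rw [← V.discOp_spec, V.discOp_eigvec, real_inner_smul_left, real_inner_self_eq_norm_sq,
      V.eigvec.orthonormal.1 m]
    simp
  have hs := E.summable_form (V.coeff_mem (V.eigvec m)) (V.coeff_mem (V.eigvec m))
  have hnn : ∀ i, 0 ≤ E.lam i * E.coeff (V.eigvec m : H) i * E.coeff (V.eigvec m : H) i :=
    fun i => by
      rw [mul_assoc]
      exact mul_nonneg (E.lam_pos i).le (mul_self_nonneg _)
  obtain ⟨i, hi⟩ : ∃ i, E.coeff (V.eigvec m : H) i ≠ 0 := by
    by_contra! h0
    have h2 := E.toH_coeff (V.eigvec m : H)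
    have h3 : E.coeff (V.eigvec m : H) = 0 := funext h0
    rw [h3] at h2
    have h4 : ((V.eigvec m : V.S) : H) = 0 := by
      rw [← h2]
      simp [Eigensystem.toH]
    have hn := V.eigvec.orthonormal.1 m
    rw [Submodule.coe_norm, h4, norm_zero] at hn
    exact zero_ne_one hn
  rw [h1]
  refine hs.tsum_pos hnn i ?_
  rw [mul_assoc]
  exact mul_pos (E.lam_pos i) (mul_self_pos.2 hi)

/-- The operator `r(A_h) x = ∑ₘ r(λ_{h,m}) (x, φ_{h,m}) φ_{h,m}` on `S`, for a real
function `r`. -/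
def funcCalc (r : ℝ → ℝ) : V.S →ₗ[ℝ] V.S where
  toFun x := ∑ m, (r (V.eigval m) * ⟪V.eigvec m, x⟫_ℝ) • V.eigvec m
  map_add' x y := by
    simp only [inner_add_right, mul_add, add_smul, Finset.sum_add_distrib]
  map_smul' c x := by
    simp only [inner_smul_right, Finset.smul_sum, smul_smul, RingHom.id_apply]
    refine Finset.sum_congr rfl fun m _ => ?_
    ring_nf

/-- The operator `R(k A_h)` of the implicit Euler scheme, `R(z) = 1 / (1 + z)`. -/
def euler (k : ℝ) : V.S →ₗ[ℝ] V.S := V.funcCalc fun l => 1 / (1 + k * l)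

/-- The generalized orthogonal projector `P_h : Ḣ^{-1} → S`,
`(P_h x, y) = ⟨x, y⟩` for all `y ∈ S`. -/
def proj (x : ι → ℝ) : V.S := V.riesz fun y => E.pairing x (E.coeff y)

theorem proj_spec {x : ι → ℝ} (hx : x ∈ E.Hdot (-1)) (y : V.S) :
    ⟪V.proj x, y⟫_ℝ = E.pairing x (E.coeff y) :=
  V.inner_riesz_form (E.inv_mul_mem hx) y

/-- The Ritz projector `R_h : Ḣ^1 → S`, `a(R_h x, y) = a(x, y)` for all `y ∈ S`; that is,
`R_h x = A_h⁻¹ z`, where `z ∈ S` represents the functional `a(x, ·)` on `S`. -/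
def ritz (x : ι → ℝ) : V.S := V.funcCalc (fun l => l⁻¹) (V.riesz fun y => E.form x (E.coeff y))

theorem discOp_funcCalcinv (x : V.S) : V.discOp (V.funcCalc (fun l => l⁻¹) x) = x := by
  conv_rhs => rw [← V.eigvec.sum_repr' x]
  simp only [funcCalc, LinearMap.coe_mk, AddHom.coe_mk, map_sum, map_smul, V.discOp_eigvec,
    smul_smul]
  refine Finset.sum_congr rfl fun m _ => ?_
  have := (V.eigval_pos m).ne'
  congr 1
  field_simp

theorem ritz_spec {x : ι → ℝ} (hx : x ∈ E.Hdot 1) (y : V.S) :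
    E.form (E.coeff (V.ritz x : H)) (E.coeff y) = E.form x (E.coeff y) := by
  rw [← V.discOp_spec, ritz, V.discOp_funcCalcinv, V.inner_riesz_form hx]

/-- `E_{kh}(t) = R(k A_h)^j` for `t ∈ [t_{j-1}, t_j)`, `j = 1, 2, …`, where `t_j = j k`. -/
def fullyDiscrete (k t : ℝ) : V.S →ₗ[ℝ] V.S := V.euler k ^ (⌊t / k⌋₊ + 1)

theorem fullyDiscrete_eq {k t : ℝ} (hk : 0 < k) {j : ℕ} (hj : 1 ≤ j)
    (h1 : ((j : ℝ) - 1) * k ≤ t) (h2 : t < j * k) : V.fullyDiscrete k t = V.euler k ^ j := by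
  obtain ⟨n, rfl⟩ : ∃ n, j = n + 1 := ⟨j - 1, by omega⟩
  push_cast at h1 h2
  rw [add_sub_cancel_right] at h1
  have h0 : 0 ≤ t / k := div_nonneg (le_trans (by positivity) h1) hk.le
  have : ⌊t / k⌋₊ = n := (Nat.floor_eq_iff h0).2
    ⟨by rwa [le_div_iff₀ hk], by rwa [div_lt_iff₀ hk]⟩
  rw [fullyDiscrete, this]

/-- On `H` the operator `P_h` is the orthogonal projector onto `S`. -/
theorem proj_coeff (x : H) (y : V.S) :
    ⟪(V.proj (E.coeff x) : H), (y : H)⟫_ℝ = ⟪x, (y : H)⟫_ℝ := by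
  have h := V.proj_spec (E.Hdot_antitone (by norm_num) (E.coeff_mem x)) y
  rw [Submodule.coe_inner] at h
  rw [h, E.pairing_eq, ← E.e.tsum_inner_mul_inner]
  exact tsum_congr fun i => by simp only [Eigensystem.coeff, real_inner_comm]

/-- The error operator `F_{kh}(t) x = E_{kh}(t) P_h x - E(t) x`. -/
def error (k t : ℝ) (x : ι → ℝ) : H := (V.fullyDiscrete k t (V.proj x) : H) - E.semigroup t x

/-- The recursion `U^j + k A_h U^j = U^{j-1}` of the implicit Euler scheme is solved by the
powers of `R(k A_h)`. -/
theorem euler_spec {k : ℝ} (hk : 0 ≤ k) (x : V.S) :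
    V.euler k x + k • V.discOp (V.euler k x) = x := by
  conv_rhs => rw [← V.eigvec.sum_repr' x]
  simp only [euler, funcCalc, LinearMap.coe_mk, AddHom.coe_mk, map_sum, map_smul,
    V.discOp_eigvec, smul_smul, Finset.smul_sum, ← Finset.sum_add_distrib, ← add_smul]
  refine Finset.sum_congr rfl fun m _ => ?_
  have : 1 + k * V.eigval m ≠ 0 := by
    have := mul_nonneg hk (V.eigval_pos m).le
    positivity
  congr 1
  field_simp

end GalerkinSpace

/-- The approximation property of a family `(S_h)_{h ∈ (0,1]}`: there is `C` with
`‖R_h x - x‖ ≤ C h^s ‖x‖_s` for all `x ∈ Ḣ^s`, `s ∈ {1, 2}`, `h ∈ (0, 1]`. -/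
def ApproximationProperty {E : Eigensystem A ι} (V : Set.Ioc (0 : ℝ) 1 → GalerkinSpace E) :
    Prop :=
  ∃ C : ℝ, ∀ s ∈ ({1, 2} : Set ℝ), ∀ h : Set.Ioc (0 : ℝ) 1, ∀ x ∈ E.Hdot s,
    ‖((V h).ritz x : H) - E.toH x‖ ≤ C * (h : ℝ) ^ s * E.hnorm s x

end

end Galerkin

end

/-! With `n = ⌊t / k⌋₊ + 1`, so that `t < n * k ≤ t + k`, the error splits as `(R(kA_h)^n P_h -
R(kA)^n) + (R(kA)^n - e^{-At})`. The second, temporal, part is diagonal in the eigenbasis of `A` and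
reduces to scalar inequalities for `(1 + u)⁻¹ ^ n - exp (-(τ * u))` with `u = kλ` and `τ = t / k`
(`temporal_error`).

The first, spatial, part rests on `P_h A z = A_h R_h z`. For `z = R(kA) x` it gives `R(kA_h) P_h x =
P_h z + (1 - R(kA_h)) (R_h z - P_h z)` (`euler_proj_sub`), and iteration turns `R(kA_h)^n P_h x -
P_h R(kA)^n x` into the discrete Duhamel sum of `y_j = (R_h - P_h) R(kA)^(j+1) x`
(`euler_pow_proj_sub`). Bounding the sum termwise would cost a logarithm. Instead it is cut in half:
where the exponent of `R(kA_h)` is large, the decay of `R(kA_h)^m (1 - R(kA_h))` like `1 / m`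
suffices; in the other half, summation by parts moves the difference onto `y_j`, which is smooth
there (`norm_duhamel_le`, `norm_duhamel_sub_shift_le`).

This gives endpoint bounds with `δ = h² + k`, up to constants: `δ` on `Ḣ^2`, `δ / t` on `H`, `√δ /
t` on `Ḣ^{-1}`. Without any cancellation one also has a constant bound on `H` and `t^{-1/2}` on
`Ḣ^{-1}`, the latter by duality (`norm_euler_pow_proj_le`). The three claims follow by interpolation
(`norm_le_of_interpolation`). -/

namespace Galerkin

/-! ### Scalar estimates for the backward Euler factor and the exponential. -/

section Scalar

/-- Bernoulli's inequality. This is the discrete smoothing property, the counterpart of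
`exp_neg_mul_le`. -/
theorem inv_one_add_pow_mul_le {u : ℝ} (hu : 0 ≤ u) (n : ℕ) :
    ((1 + u)⁻¹) ^ n * (n * u) ≤ 1 := by
  have h := one_add_mul_le_pow (show (-2 : ℝ) ≤ u by linarith) n
  rw [inv_pow, inv_mul_le_one₀ (by positivity)]
  linarith

theorem inv_one_add_pow_le_one {u : ℝ} (hu : 0 ≤ u) (n : ℕ) : ((1 + u)⁻¹) ^ n ≤ 1 :=
  pow_le_one₀ (by positivity) (inv_le_one_of_one_le₀ (by linarith))

theorem inv_one_add_pow_sub_nonneg {u : ℝ} (hu : 0 ≤ u) (n : ℕ) :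
    0 ≤ ((1 + u)⁻¹) ^ n * (1 - (1 + u)⁻¹) :=
  mul_nonneg (by positivity) (sub_nonneg.2 (inv_le_one_of_one_le₀ (by linarith)))

/-- Since `1 - (1 + u)⁻¹ = u * (1 + u)⁻¹`, this is the smoothing bound for the power `n + 1`.
Uniformity in `u` makes it a bound for operators, both for `A` and for `A_h`. -/
theorem inv_one_add_pow_sub_le {u : ℝ} (hu : 0 ≤ u) (n : ℕ) :
    ((1 + u)⁻¹) ^ n * (1 - (1 + u)⁻¹) ≤ 1 / (n + 1) := by
  have h := inv_one_add_pow_mul_le hu (n + 1)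
  have h1 : 1 - (1 + u)⁻¹ = (1 + u)⁻¹ * u := by field_simp; ring
  rw [h1, le_div_iff₀ (by positivity)]
  rw [pow_succ] at h
  push_cast at h
  linarith

theorem exp_neg_mul_le {v : ℝ} : Real.exp (-v) * v ≤ 1 := by
  rw [Real.exp_neg, inv_mul_le_one₀ (Real.exp_pos _)]
  linarith [Real.add_one_le_exp v]

/-- The error of the rational approximation on the grid. -/
theorem euler_pow_sub_exp {u : ℝ} (hu : 0 ≤ u) (n : ℕ) :
    0 ≤ ((1 + u)⁻¹) ^ n - Real.exp (-(n * u)) ∧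
      ((1 + u)⁻¹) ^ n - Real.exp (-(n * u)) ≤ n * u ^ 2 * ((1 + u)⁻¹) ^ n := by
  have he : Real.exp (-(n * u)) = Real.exp (-u) ^ n := by
    rw [← Real.exp_nat_mul]; congr 1; ring
  have h0 : Real.exp (-u) ≤ (1 + u)⁻¹ := by
    rw [Real.exp_neg]
    exact inv_anti₀ (by linarith) (by linarith [Real.add_one_le_exp u])
  have h1 : 1 - u ≤ Real.exp (-u) := by linarith [Real.add_one_le_exp (-u)]
  rw [he]
  refine ⟨sub_nonneg.2 (pow_le_pow_left₀ (Real.exp_pos _).le h0 n), ?_⟩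
  have h2 : (1 + u)⁻¹ - Real.exp (-u) ≤ u ^ 2 * (1 + u)⁻¹ := by
    have : (1 + u)⁻¹ = 1 - u + u ^ 2 * (1 + u)⁻¹ := by field_simp; ring
    linarith
  induction n with
  | zero => simp
  | succ n ih =>
    have hr : (0 : ℝ) ≤ (1 + u)⁻¹ := by positivity
    have hp := pow_le_pow_left₀ (Real.exp_pos _).le h0 n
    -- Telescoping: the error of one step is propagated by the scheme, and the new local error `u ^
    -- 2 * (1 + u)⁻¹` is carried by an exponential dominated by `(1 + u)⁻¹ ^ n`.
    have ha : (1 + u)⁻¹ ^ (n + 1) - Real.exp (-u) ^ (n + 1)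
        = (1 + u)⁻¹ * ((1 + u)⁻¹ ^ n - Real.exp (-u) ^ n)
          + Real.exp (-u) ^ n * ((1 + u)⁻¹ - Real.exp (-u)) := by ring
    have hb := mul_le_mul_of_nonneg_left (ih (by
      rw [← Real.exp_nat_mul]; congr 1; ring)) hr
    have hc := mul_le_mul hp h2 (sub_nonneg.2 h0) (by positivity)
    rw [ha]
    refine (add_le_add hb hc).trans_eq ?_
    push_cast
    ring

variable {u τ : ℝ} {n : ℕ}

/-- Moving from time `τ` to the next grid point `n` costs at most one step, because `n - τ ∈ [0,
1]`. -/
theorem exp_sub_exp_le (hu : 0 ≤ u) (h2 : τ ≤ n) (h1 : (n : ℝ) ≤ τ + 1) :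
    0 ≤ Real.exp (-(τ * u)) - Real.exp (-(n * u)) ∧
      Real.exp (-(τ * u)) - Real.exp (-(n * u)) ≤ u * Real.exp (-(τ * u)) := by
  have h : Real.exp (-(n * u)) = Real.exp (-(τ * u)) * Real.exp (-((n - τ) * u)) := by
    rw [← Real.exp_add]; congr 1; ring
  have h3 : 1 - (n - τ) * u ≤ Real.exp (-((n - τ) * u)) := by
    linarith [Real.add_one_le_exp (-((n - τ) * u))]
  have h4 : Real.exp (-((n - τ) * u)) ≤ 1 :=
    Real.exp_le_one_iff.2 (by nlinarith)
  have h5 := Real.exp_pos (-(τ * u))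
  rw [h]
  constructor
  · nlinarith
  · have : 1 - Real.exp (-((n - τ) * u)) ≤ u := by nlinarith
    nlinarith

/-- First order accuracy of the backward Euler scheme for a single mode. -/
theorem abs_euler_sub_exp_le (hu : 0 ≤ u) (hτ : 0 ≤ τ) (h2 : τ ≤ n) (h1 : (n : ℝ) ≤ τ + 1) :
    |((1 + u)⁻¹) ^ n - Real.exp (-(τ * u))| ≤ u := by
  obtain ⟨a1, a2⟩ := euler_pow_sub_exp hu n
  obtain ⟨b1, b2⟩ := exp_sub_exp_le hu h2 h1
  have h3 := inv_one_add_pow_mul_le hu n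
  have h4 : Real.exp (-(τ * u)) ≤ 1 := Real.exp_le_one_iff.2 (by nlinarith)
  have h5 := mul_le_mul_of_nonneg_left h4 hu
  have h6 := mul_le_mul_of_nonneg_left h3 hu
  -- The quantity is the grid error minus the shift from `τ` to `n`. Both are nonnegative, so each
  -- alone controls one side.
  rw [abs_le]
  constructor <;> nlinarith

/-- Nonsmooth data accuracy of the backward Euler scheme for a single mode. -/
theorem abs_euler_sub_exp_mul_le (hu : 0 ≤ u) (hτ : 0 ≤ τ) (h2 : τ ≤ n) (h1 : (n : ℝ) ≤ τ + 1) :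
    |((1 + u)⁻¹) ^ n - Real.exp (-(τ * u))| * τ ≤ 6 := by
  obtain ⟨a1, a2⟩ := euler_pow_sub_exp hu n
  obtain ⟨b1, b2⟩ := exp_sub_exp_le hu h2 h1
  have h3 : Real.exp (-(τ * u)) * (τ * u) ≤ 1 := exp_neg_mul_le
  have hn := Nat.cast_nonneg (α := ℝ) n
  have h4 : (((1 + u)⁻¹) ^ n - Real.exp (-(n * u))) * n ≤ 6 := by
    rcases Nat.lt_or_ge n 2 with hn2 | hn2
    · have h5 := inv_one_add_pow_le_one hu n
      have h6 := Real.exp_pos (-(n * u))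
      have h7 : (n : ℝ) ≤ 1 := by exact_mod_cast Nat.lt_succ_iff.1 hn2
      nlinarith
    · refine (mul_le_mul_of_nonneg_right a2 hn).trans ?_
      -- Two factors `n * u` have to be absorbed by `(1 + u)⁻¹ ^ n`; each half of the power absorbs
      -- one. The constant `6 = 3 * 2` comes from rounding `n / 2`, with `n = 3` the worst case for
      -- `p`.
      obtain ⟨p, q, rfl, hp, hq⟩ : ∃ p q : ℕ, n = p + q ∧ p + q ≤ 3 * p ∧ p + q ≤ 2 * q :=
        ⟨n / 2, n - n / 2, by omega, by omega, by omega⟩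
      have hp' : ((p + q : ℕ) : ℝ) ≤ 3 * p := by exact_mod_cast hp
      have hq' : ((p + q : ℕ) : ℝ) ≤ 2 * q := by exact_mod_cast hq
      have e1 := inv_one_add_pow_mul_le hu p
      have e2 := inv_one_add_pow_mul_le hu q
      have e3 : ((1 + u)⁻¹) ^ p * (p * u) * (((1 + u)⁻¹) ^ q * (q * u)) ≤ 1 :=
        mul_le_one₀ e1 (by positivity) e2
      have e4 := mul_le_mul hp' hq' hn (by positivity)
      have e5 : 0 ≤ u ^ 2 * (1 + u)⁻¹ ^ (p + q) := by positivity
      calc _ = (((p + q : ℕ) : ℝ) * ((p + q : ℕ) : ℝ)) * (u ^ 2 * (1 + u)⁻¹ ^ (p + q)) := by ring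
        _ ≤ (3 * p * (2 * q)) * (u ^ 2 * (1 + u)⁻¹ ^ (p + q)) :=
            mul_le_mul_of_nonneg_right e4 e5
        _ = 6 * (((1 + u)⁻¹) ^ p * (p * u) * (((1 + u)⁻¹) ^ q * (q * u))) := by
            rw [pow_add]; ring
        _ ≤ 6 := by linarith
  have h5 := mul_le_mul_of_nonneg_left h2 a1
  have h6 := mul_le_mul_of_nonneg_right b2 hτ
  rw [← abs_of_nonneg hτ, ← abs_mul, abs_of_nonneg hτ, abs_le]
  constructor <;> nlinarith [mul_nonneg a1 hτ, mul_nonneg b1 hτ]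

/-- No cancellation is used: both terms have this smoothing bound. Multiplied with
`abs_euler_sub_exp_mul_le` it yields the half-order estimate for data in `Ḣ^{-1}`. -/
theorem abs_euler_sub_exp_mul_mul_le (hu : 0 ≤ u) (hτ : 0 ≤ τ) (h2 : τ ≤ n) :
    |((1 + u)⁻¹) ^ n - Real.exp (-(τ * u))| * (τ * u) ≤ 1 := by
  have h3 : Real.exp (-(τ * u)) * (τ * u) ≤ 1 := exp_neg_mul_le
  have h4 : ((1 + u)⁻¹) ^ n * (τ * u) ≤ 1 :=
    (mul_le_mul_of_nonneg_left (mul_le_mul_of_nonneg_right h2 hu) (by positivity)).trans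
      (inv_one_add_pow_mul_le hu n)
  have h5 : 0 ≤ τ * u := by positivity
  have h6 : 0 ≤ ((1 + u)⁻¹) ^ n * (τ * u) := by positivity
  have h7 : 0 ≤ Real.exp (-(τ * u)) * (τ * u) := by positivity
  rw [← abs_of_nonneg h5, ← abs_mul, abs_of_nonneg h5, abs_le]
  constructor <;> nlinarith

end Scalar

/-! ### Weighted sequence norms, multipliers and interpolation. -/

namespace Eigensystem

variable {H : Type*} [NormedAddCommGroup H] [InnerProductSpace ℝ H] [CompleteSpace H]
  {A : EllipticOperator H} {ι : Type*} (E : Eigensystem A ι)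

theorem hnorm_nonneg (r : ℝ) (x : ι → ℝ) : 0 ≤ E.hnorm r x := Real.sqrt_nonneg _

theorem hnorm_sq (r : ℝ) (x : ι → ℝ) : E.hnorm r x ^ 2 = ∑' i, E.lam i ^ r * x i ^ 2 :=
  Real.sq_sqrt (tsum_nonneg fun i =>
    mul_nonneg (Real.rpow_nonneg (E.lam_pos i).le r) (sq_nonneg _))

/-- Comparison of two formal series, coefficient by coefficient. -/
theorem mem_and_hnorm_le {r s M : ℝ} (hM : 0 ≤ M) {x y : ι → ℝ} (hx : x ∈ E.Hdot r)
    (h : ∀ i, E.lam i ^ s * y i ^ 2 ≤ M ^ 2 * (E.lam i ^ r * x i ^ 2)) :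
    y ∈ E.Hdot s ∧ E.hnorm s y ≤ M * E.hnorm r x := by
  have hx' : Summable fun i => E.lam i ^ r * x i ^ 2 := hx
  have hy : Summable fun i => E.lam i ^ s * y i ^ 2 :=
    Summable.of_nonneg_of_le
      (fun i => mul_nonneg (Real.rpow_nonneg (E.lam_pos i).le s) (sq_nonneg _)) h
      (hx'.mul_left (M ^ 2))
  refine ⟨hy, abs_le_of_sq_le_sq' ?_ (mul_nonneg hM (E.hnorm_nonneg r x)) |>.2⟩
  rw [mul_pow, hnorm_sq, hnorm_sq, ← tsum_mul_left]
  exact hy.tsum_le_tsum h (hx'.mul_left _)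

/-- Boundedness of a multiplier from `Ḣ^r` to `Ḣ^s`. -/
theorem mul_mem_and_hnorm_le {r s M : ℝ} (hM : 0 ≤ M) {g x : ι → ℝ} (hx : x ∈ E.Hdot r)
    (h : ∀ i, E.lam i ^ s * g i ^ 2 ≤ M ^ 2 * E.lam i ^ r) :
    (fun i => g i * x i) ∈ E.Hdot s ∧ E.hnorm s (fun i => g i * x i) ≤ M * E.hnorm r x := by
  refine E.mem_and_hnorm_le hM hx fun i => ?_
  have := mul_le_mul_of_nonneg_right (h i) (sq_nonneg (x i))
  linarith [mul_pow (g i) (x i) 2]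

/-- A multiplier that is bounded by `M` acts on every `Ḣ^r`. -/
theorem mul_mem_and_hnorm_le_same (r : ℝ) {M : ℝ} {g x : ι → ℝ} (hM : 0 ≤ M) (hx : x ∈ E.Hdot r)
    (h : ∀ i, |g i| ≤ M) :
    (fun i => g i * x i) ∈ E.Hdot r ∧ E.hnorm r (fun i => g i * x i) ≤ M * E.hnorm r x := by
  refine E.mul_mem_and_hnorm_le hM hx fun i => ?_
  have h1 : g i ^ 2 ≤ M ^ 2 := sq_le_sq' (abs_le.1 (h i)).1 (abs_le.1 (h i)).2
  nlinarith [Real.rpow_nonneg (E.lam_pos i).le r]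

theorem coeff_toH {x : ι → ℝ} (hx : x ∈ E.Hdot 0) : E.coeff (E.toH x) = x := by
  funext i
  have h := (E.hasSum_toH hx).mapL (innerSL ℝ (E.e i))
  classical
  have h2 : (fun j => innerSL ℝ (E.e i) (x j • E.e j)) = fun j => if j = i then x i else 0 := by
    funext j
    rw [innerSL_apply_apply, inner_smul_right, orthonormal_iff_ite.1 E.e.orthonormal i j]
    by_cases hj : j = i
    · subst hj; simp
    · simp [hj, Ne.symm hj]
  rw [h2] at h
  exact h.unique (hasSum_ite_eq i (x i))

theorem inner_eq_tsum_coeff (X Y : H) : ⟪X, Y⟫_ℝ = ∑' i, E.coeff X i * E.coeff Y i := by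
  rw [← E.e.tsum_inner_mul_inner]
  exact tsum_congr fun i => by simp only [coeff, real_inner_comm]

theorem hnorm_zero_coeff (X : H) : E.hnorm 0 (E.coeff X) = ‖X‖ := by
  refine (sq_eq_sq₀ (E.hnorm_nonneg _ _) (norm_nonneg _)).1 ?_
  rw [hnorm_sq, ← real_inner_self_eq_norm_sq, E.inner_eq_tsum_coeff]
  exact tsum_congr fun i => by rw [Real.rpow_zero]; ring

theorem norm_toH {x : ι → ℝ} (hx : x ∈ E.Hdot 0) : ‖E.toH x‖ = E.hnorm 0 x := by
  rw [← E.hnorm_zero_coeff, E.coeff_toH hx]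

theorem toH_add {x y : ι → ℝ} (hx : x ∈ E.Hdot 0) (hy : y ∈ E.Hdot 0) :
    E.toH (x + y) = E.toH x + E.toH y := by
  refine (E.hasSum_toH (add_mem hx hy)).unique ?_
  simpa [add_smul] using (E.hasSum_toH hx).add (E.hasSum_toH hy)

/-- Cauchy–Schwarz for the form `a`. -/
theorem abs_form_le {x y : ι → ℝ} (hx : x ∈ E.Hdot 1) (hy : y ∈ E.Hdot 1) :
    |E.form x y| ≤ E.hnorm 1 x * E.hnorm 1 y := by
  have key : ∀ z ∈ E.Hdot 1, (fun i => E.lam i ^ (1 / 2 : ℝ) * z i) ∈ E.Hdot 0 ∧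
      E.hnorm 0 (fun i => E.lam i ^ (1 / 2 : ℝ) * z i) ≤ 1 * E.hnorm 1 z := by
    intro z hz
    refine E.mul_mem_and_hnorm_le zero_le_one hz fun i => ?_
    rw [← Real.rpow_natCast, ← Real.rpow_mul (E.lam_pos i).le]
    norm_num
  obtain ⟨h1, h1'⟩ := key x hx
  obtain ⟨h2, h2'⟩ := key y hy
  have h : E.form x y = ⟪E.toH (fun i => E.lam i ^ (1 / 2 : ℝ) * x i),
      E.toH (fun i => E.lam i ^ (1 / 2 : ℝ) * y i)⟫_ℝ := by
    rw [E.inner_eq_tsum_coeff, E.coeff_toH h1, E.coeff_toH h2]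
    refine tsum_congr fun i => ?_
    have : E.lam i ^ (1 / 2 : ℝ) * E.lam i ^ (1 / 2 : ℝ) = E.lam i := by
      rw [← Real.rpow_add (E.lam_pos i)]; norm_num
    linear_combination (-(x i * y i)) * this
  rw [h]
  refine (abs_real_inner_le_norm _ _).trans ?_
  rw [E.norm_toH h1, E.norm_toH h2]
  rw [one_mul] at h1' h2'
  exact mul_le_mul h1' h2' (E.hnorm_nonneg _ _) (E.hnorm_nonneg _ _)

theorem abs_pairing_le {x y : ι → ℝ} (hx : x ∈ E.Hdot (-1)) (hy : y ∈ E.Hdot 1) :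
    |E.pairing x y| ≤ E.hnorm (-1) x * E.hnorm 1 y := by
  refine (E.abs_form_le (E.inv_mul_mem hx) hy).trans ?_
  refine mul_le_mul_of_nonneg_right ?_ (E.hnorm_nonneg _ _)
  have := (E.mul_mem_and_hnorm_le (s := 1) (M := 1) (g := fun i => (E.lam i)⁻¹) zero_le_one hx
    fun i => ?_).2
  · rwa [one_mul] at this
  · have := (E.lam_pos i).ne'
    rw [Real.rpow_one, Real.rpow_neg_one]
    apply le_of_eq
    field_simp

/-- Interpolation between two weighted norms, by splitting the frequencies. -/
theorem norm_le_of_interpolation {G : Type*} [NormedAddCommGroup G] {Φ : (ι → ℝ) → G}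
    {r₀ r₁ M₀ M₁ θ : ℝ} (hr : r₀ ≤ r₁) (hM₀ : 0 < M₀) (hM₁ : 0 < M₁) (hθ : 0 ≤ θ) (hθ' : θ ≤ 1)
    (hadd : ∀ x ∈ E.Hdot r₀, ∀ y ∈ E.Hdot r₀, Φ (x + y) = Φ x + Φ y)
    (h₀ : ∀ x ∈ E.Hdot r₀, ‖Φ x‖ ≤ M₀ * E.hnorm r₀ x)
    (h₁ : ∀ x ∈ E.Hdot r₁, ‖Φ x‖ ≤ M₁ * E.hnorm r₁ x)
    {x : ι → ℝ} (hx : x ∈ E.Hdot ((1 - θ) * r₀ + θ * r₁)) :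
    ‖Φ x‖ ≤ 2 * (M₀ ^ (1 - θ) * M₁ ^ θ) * E.hnorm ((1 - θ) * r₀ + θ * r₁) x := by
  classical
  set r := (1 - θ) * r₀ + θ * r₁ with hrdef
  set M := M₀ ^ (1 - θ) * M₁ ^ θ with hM
  have hMpos : 0 < M := by positivity
  -- At every frequency the target weight is the geometric mean of the two endpoint weights, so it
  -- dominates the smaller of them.
  have hMsq : ∀ i, M ^ 2 * E.lam i ^ r
      = (M₀ ^ 2 * E.lam i ^ r₀) ^ (1 - θ) * (M₁ ^ 2 * E.lam i ^ r₁) ^ θ := by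
    intro i
    have hl := E.lam_pos i
    rw [Real.mul_rpow (by positivity) (by positivity),
      Real.mul_rpow (by positivity) (by positivity), ← Real.rpow_mul hl.le, ← Real.rpow_mul hl.le,
      ← Real.rpow_natCast, ← Real.rpow_natCast, ← Real.rpow_natCast, ← Real.rpow_mul hM₀.le,
      ← Real.rpow_mul hM₁.le, hM, Real.mul_rpow (by positivity) (by positivity),
      ← Real.rpow_mul hM₀.le, ← Real.rpow_mul hM₁.le, hrdef, Real.rpow_add hl,
      mul_comm (1 - θ) ((2 : ℕ) : ℝ), mul_comm θ ((2 : ℕ) : ℝ), mul_comm (1 - θ) r₀,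
      mul_comm θ r₁]
    ring
  have hgeo : ∀ a b : ℝ, 0 < a → 0 < b → a ≤ b →
      a ≤ b ^ (1 - θ) * a ^ θ ∧ a ≤ a ^ (1 - θ) * b ^ θ := by
    intro a b ha hb hab
    have e : a = a ^ (1 - θ) * a ^ θ := by
      rw [← Real.rpow_add ha, sub_add_cancel, Real.rpow_one]
    have h1 : a ^ (1 - θ) ≤ b ^ (1 - θ) := Real.rpow_le_rpow ha.le hab (by linarith)
    have h2 : a ^ θ ≤ b ^ θ := Real.rpow_le_rpow ha.le hab hθ
    constructor
    · calc a = a ^ (1 - θ) * a ^ θ := e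
        _ ≤ _ := mul_le_mul_of_nonneg_right h1 (by positivity)
    · calc a = a ^ (1 - θ) * a ^ θ := e
        _ ≤ _ := mul_le_mul_of_nonneg_left h2 (by positivity)
  -- The frequencies where the `r₁` bound is the cheaper one. The series is cut along `p`, and each
  -- piece goes to its better endpoint; the factor `2` is the sum of the two pieces. Only additivity
  -- of `Φ` is needed.
  let p : ι → Prop := fun i => M₁ ^ 2 * E.lam i ^ r₁ ≤ M₀ ^ 2 * E.lam i ^ r₀
  have hlow := E.mul_mem_and_hnorm_le (s := r₁) (M := M / M₁)
    (g := fun i => if p i then 1 else 0) (by positivity) hx fun i => by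
      have hl := E.lam_pos i
      by_cases hp : p i
      · have := (hgeo _ _ (by positivity) (by positivity) hp).1
        rw [← hMsq] at this
        simp only [hp, if_true]
        rw [div_pow, div_mul_eq_mul_div, le_div_iff₀ (by positivity)]
        linarith
      · simp only [hp, if_false]
        have : 0 ≤ (M / M₁) ^ 2 * E.lam i ^ r := by positivity
        simpa using this
  have hhigh := E.mul_mem_and_hnorm_le (s := r₀) (M := M / M₀)
    (g := fun i => if p i then 0 else 1) (by positivity) hx fun i => by
      have hl := E.lam_pos i
      by_cases hp : p i
      · simp only [hp, if_true]
        have : 0 ≤ (M / M₀) ^ 2 * E.lam i ^ r := by positivity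
        simpa using this
      · have := (hgeo _ _ (by positivity) (by positivity) (not_le.1 hp).le).2
        rw [← hMsq] at this
        simp only [hp, if_false]
        rw [div_pow, div_mul_eq_mul_div, le_div_iff₀ (by positivity)]
        linarith
  have hsum : x = (fun i => (if p i then (1 : ℝ) else 0) * x i)
      + fun i => (if p i then (0 : ℝ) else 1) * x i := by
    funext i
    by_cases hp : p i <;> simp [hp]
  have hΦ := hadd _ (E.Hdot_antitone hr hlow.1) _ hhigh.1
  rw [← hsum] at hΦ
  rw [hΦ]
  refine (norm_add_le _ _).trans ?_
  have a1 := (h₁ _ hlow.1).trans (mul_le_mul_of_nonneg_left hlow.2 hM₁.le)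
  have a2 := (h₀ _ hhigh.1).trans (mul_le_mul_of_nonneg_left hhigh.2 hM₀.le)
  rw [← mul_assoc, mul_div_cancel₀ _ hM₁.ne'] at a1
  rw [← mul_assoc, mul_div_cancel₀ _ hM₀.ne'] at a2
  linarith

end Eigensystem

end Galerkin

namespace Galerkin

/-! ### Discrete Duhamel sums for a contraction. -/

section DiscreteConvolution

variable {F : Type*} [NormedAddCommGroup F] [NormedSpace ℝ F]

/-- The discrete Duhamel sum `∑_{j<n} c^{n-1-j} (1 - c) y_j`. -/
def duhamel (c : F →ₗ[ℝ] F) (y : ℕ → F) : ℕ → F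
  | 0 => 0
  | n + 1 => c (duhamel c y n) + (y n - c (y n))

variable {c : F →ₗ[ℝ] F}

theorem duhamel_add (y : ℕ → F) (m n : ℕ) :
    duhamel c y (m + n) = (c ^ n) (duhamel c y m) + duhamel c (fun j => y (m + j)) n := by
  induction n with
  | zero => simp [duhamel]
  | succ n ih =>
    rw [← add_assoc, duhamel, ih, duhamel, pow_succ', Module.End.mul_apply, map_add]
    abel

/-- Every one of the `m` terms carries `c ^ i * (1 - c)` with `i ≥ n`, hence is at most `κ / (n +
1)`. -/
theorem norm_pow_duhamel_le
    (hc : ∀ (m : ℕ) v, ‖(c ^ m) (v - c v)‖ ≤ ‖v‖ / (m + 1)) {y : ℕ → F} {κ : ℝ}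
    (hκ : 0 ≤ κ) (hy : ∀ j, ‖y j‖ ≤ κ) (m n : ℕ) :
    ‖(c ^ n) (duhamel c y m)‖ ≤ m * (κ / (n + 1)) := by
  induction m generalizing n with
  | zero => simp [duhamel]
  | succ m ih =>
    rw [duhamel, map_add, ← Module.End.mul_apply, ← pow_succ]
    refine (norm_add_le _ _).trans ?_
    have h1 := ih (n + 1)
    have h2 := hc n (y m)
    have h3 : ‖y m‖ / (n + 1 : ℝ) ≤ κ / (n + 1) := by gcongr; exact hy m
    have h4 : κ / ((n + 1 : ℕ) + 1 : ℝ) ≤ κ / (n + 1) := by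
      gcongr; linarith
    have h5 := mul_le_mul_of_nonneg_left h4 (Nat.cast_nonneg (α := ℝ) m)
    push_cast at *
    linarith

/-- Summation by parts: the vector on the left is `∑_{j<n} c^{n-1-j} (y_j - y_{j+1})`, and
contractivity bounds it term by term. -/
theorem norm_duhamel_sub_le (hc : ∀ v, ‖c v‖ ≤ ‖v‖) {y : ℕ → F} {η : ℝ}
    (hy : ∀ j, ‖y j - y (j + 1)‖ ≤ η) (n : ℕ) :
    ‖duhamel c y n - y n + (c ^ n) (y 0)‖ ≤ n * η := by
  induction n with
  | zero => simp [duhamel]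
  | succ n ih =>
    have h : duhamel c y (n + 1) - y (n + 1) + (c ^ (n + 1)) (y 0)
        = c (duhamel c y n - y n + (c ^ n) (y 0)) + (y n - y (n + 1)) := by
      rw [duhamel, pow_succ', Module.End.mul_apply, map_add, map_sub]
      abel
    rw [h]
    refine (norm_add_le _ _).trans ?_
    have h1 := (hc _).trans ih
    have h2 := hy n
    push_cast
    linarith

theorem norm_pow_le (hc : ∀ v, ‖c v‖ ≤ ‖v‖) (n : ℕ) (v : F) : ‖(c ^ n) v‖ ≤ ‖v‖ := by
  induction n with
  | zero => simp
  | succ n ih =>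
    rw [pow_succ', Module.End.mul_apply]
    exact (hc _).trans ih

/-- The sum is halved. The early terms, smoothed by high powers of `c`, contribute `κ`. The late
terms, summed by parts, contribute `κ` plus two boundary terms of size `κ`. -/
theorem norm_duhamel_le (hc : ∀ v, ‖c v‖ ≤ ‖v‖)
    (hc' : ∀ (m : ℕ) v, ‖(c ^ m) (v - c v)‖ ≤ ‖v‖ / (m + 1)) {y : ℕ → F} {κ : ℝ}
    (hκ : 0 ≤ κ) (hy : ∀ j, ‖y j‖ ≤ κ) (hy' : ∀ j : ℕ, ‖y j - y (j + 1)‖ ≤ κ / (j + 1)) (n : ℕ) :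
    ‖duhamel c y n‖ ≤ 4 * κ := by
  obtain ⟨m, p, rfl, hmp, hpm⟩ : ∃ m p : ℕ, n = m + p ∧ m ≤ p + 1 ∧ p ≤ m + 1 :=
    ⟨n / 2, n - n / 2, by omega, by omega, by omega⟩
  have hbd : ∀ a b : ℕ, a ≤ b + 1 → (a : ℝ) * (κ / (b + 1)) ≤ κ := by
    intro a b hab
    have : (a : ℝ) ≤ b + 1 := by exact_mod_cast hab
    rw [mul_div_left_comm]
    exact mul_le_of_le_one_right hκ ((div_le_one (by positivity)).2 this)
  have h1 := (norm_pow_duhamel_le hc' hκ hy m p).trans (hbd m p hmp)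
  have h2 := (norm_duhamel_sub_le hc (y := fun j => y (m + j)) (η := κ / (m + 1))
    (fun j => (hy' (m + j)).trans (by gcongr; linarith [Nat.cast_nonneg (α := ℝ) j]))
    p).trans (hbd p m hpm)
  have h3 := (norm_pow_le hc p (y (m + 0))).trans (hy _)
  have h4 := hy (m + p)
  rw [duhamel_add]
  have h5 : duhamel c (fun j => y (m + j)) p
      = (duhamel c (fun j => y (m + j)) p - y (m + p) + (c ^ p) (y (m + 0)))
        + (y (m + p) - (c ^ p) (y (m + 0))) := by abel
  have h6 : ‖duhamel c (fun j => y (m + j)) p‖ ≤ κ + (κ + κ) := by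
    rw [h5]
    exact (norm_add_le _ _).trans (add_le_add h2 ((norm_sub_le _ _).trans (add_le_add h4 h3)))
  linarith [norm_add_le ((c ^ p) (duhamel c y m)) (duhamel c (fun j => y (m + j)) p)]

/-- All factors commute with `c`, so `1 - c` can be pulled out of the sum, leaving the
summed-by-parts form of `duhamel c w n`. A further power of `c` can then act on that factor. -/
theorem duhamel_sub_shift (w : ℕ → F) (n : ℕ) :
    duhamel c (fun j => w j - w (j + 1)) n
      = (duhamel c w n - w n + (c ^ n) (w 0)) - c (duhamel c w n - w n + (c ^ n) (w 0)) := by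
  induction n with
  | zero => simp [duhamel]
  | succ n ih =>
    simp only [duhamel, ih, pow_succ', Module.End.mul_apply, map_add, map_sub]
    abel

/-- For the early half, `c ^ p` meets the extracted factor `1 - c` and gives `6 * κ / (p + 1)`. The
late half is an instance of `norm_duhamel_le` with `κ / (m + 1)` in place of `κ`, which is why
second differences are assumed in product form. The total is `10 * κ / (m + 1)`, and `m + p + 1 ≤ 2
* (m + 1)`. -/
theorem norm_duhamel_sub_shift_le (hc : ∀ v, ‖c v‖ ≤ ‖v‖)
    (hc' : ∀ (m : ℕ) v, ‖(c ^ m) (v - c v)‖ ≤ ‖v‖ / (m + 1)) {w : ℕ → F} {κ : ℝ}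
    (hκ : 0 ≤ κ) (hw : ∀ j, ‖w j‖ ≤ κ) (hw' : ∀ j : ℕ, ‖w j - w (j + 1)‖ ≤ κ / (j + 1))
    (hw'' : ∀ m j : ℕ, ‖(w (m + j) - w (m + j + 1)) - (w (m + j + 1) - w (m + j + 2))‖
      ≤ κ / (m + 1) / (j + 1)) (n : ℕ) :
    ‖duhamel c (fun j => w j - w (j + 1)) n‖ ≤ 20 * κ / (n + 1) := by
  obtain ⟨m, p, rfl, hmp, hpm⟩ : ∃ m p : ℕ, n = m + p ∧ m ≤ p ∧ p ≤ m + 1 :=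
    ⟨n / 2, n - n / 2, by omega, by omega, by omega⟩
  have hmp' : (m : ℝ) ≤ p := by exact_mod_cast hmp
  have hpm' : (p : ℝ) ≤ m + 1 := by exact_mod_cast hpm
  have h1 : ‖duhamel c (fun j => w (m + j) - w (m + j + 1)) p‖ ≤ 4 * (κ / (m + 1)) := by
    refine norm_duhamel_le hc hc' (by positivity) (fun j => (hw' (m + j)).trans ?_)
      (fun j => hw'' m j) p
    gcongr
    linarith [Nat.cast_nonneg (α := ℝ) j]
  have h2 : ‖duhamel c w m - w m + (c ^ m) (w 0)‖ ≤ 6 * κ := by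
    have ha := norm_duhamel_le hc hc' hκ hw hw' m
    have hb := (norm_pow_le hc m (w 0)).trans (hw 0)
    have hd := norm_add_le (duhamel c w m - w m) ((c ^ m) (w 0))
    linarith [norm_sub_le (duhamel c w m) (w m), hw m]
  have h3 := hc' p (duhamel c w m - w m + (c ^ m) (w 0))
  rw [duhamel_add, duhamel_sub_shift w m]
  have h4 : ‖duhamel c w m - w m + (c ^ m) (w 0)‖ / (p + 1 : ℝ) ≤ 6 * κ / (m + 1) := by
    gcongr
  have h5 : 6 * κ / (m + 1) + 4 * (κ / (m + 1)) ≤ 20 * κ / ((m + p : ℕ) + 1) := by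
    rw [← mul_div_assoc, ← add_div, div_le_div_iff₀ (by positivity) (by positivity)]
    push_cast
    nlinarith
  exact (norm_add_le _ _).trans ((add_le_add (h3.trans h4) h1).trans h5)

end DiscreteConvolution

end Galerkin

namespace Galerkin

/-! ### Spectral calculus, projectors and the one-step identity on a Galerkin space. -/

namespace GalerkinSpace

variable {H : Type*} [NormedAddCommGroup H] [InnerProductSpace ℝ H] [CompleteSpace H]
  {A : EllipticOperator H} {ι : Type*} {E : Eigensystem A ι} (V : GalerkinSpace E)

theorem inner_eigvec_funcCalc (r : ℝ → ℝ) (x : V.S) (m : Fin (Module.finrank ℝ V.S)) :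
    ⟪V.eigvec m, V.funcCalc r x⟫_ℝ = r (V.eigval m) * ⟪V.eigvec m, x⟫_ℝ := by
  simp only [funcCalc, LinearMap.coe_mk, AddHom.coe_mk]
  exact V.eigvec.orthonormal.inner_right_fintype _ m

theorem ext_eigvec {x y : V.S} (h : ∀ m, ⟪V.eigvec m, x⟫_ℝ = ⟪V.eigvec m, y⟫_ℝ) : x = y := by
  rw [← V.eigvec.sum_repr' x, ← V.eigvec.sum_repr' y]
  exact Finset.sum_congr rfl fun m _ => by rw [h m]

theorem norm_sq_eq_sum (x : V.S) : ‖x‖ ^ 2 = ∑ m, ⟪V.eigvec m, x⟫_ℝ ^ 2 := by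
  rw [← V.eigvec.sum_sq_norm_inner_right x]
  exact Finset.sum_congr rfl fun m _ => by rw [Real.norm_eq_abs, sq_abs]

theorem funcCalc_comp (r s : ℝ → ℝ) (x : V.S) :
    V.funcCalc r (V.funcCalc s x) = V.funcCalc (fun l => r l * s l) x :=
  V.ext_eigvec fun m => by simp only [inner_eigvec_funcCalc]; ring

theorem discOp_eq_funcCalc (x : V.S) : V.discOp x = V.funcCalc (fun l => l) x :=
  V.ext_eigvec fun m => by
    rw [inner_eigvec_funcCalc, ← V.discOp_symmetric, V.discOp_eigvec, real_inner_smul_left]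

theorem funcCalc_symmetric (r : ℝ → ℝ) (x y : V.S) :
    ⟪V.funcCalc r x, y⟫_ℝ = ⟪x, V.funcCalc r y⟫_ℝ := by
  rw [← V.eigvec.sum_inner_mul_inner, ← V.eigvec.sum_inner_mul_inner]
  refine Finset.sum_congr rfl fun m _ => ?_
  rw [real_inner_comm, inner_eigvec_funcCalc, inner_eigvec_funcCalc,
    real_inner_comm (V.eigvec m) x]
  ring

theorem norm_funcCalc_le {r : ℝ → ℝ} {M : ℝ} (hM : 0 ≤ M) (hr : ∀ l, 0 < l → |r l| ≤ M)
    (x : V.S) : ‖V.funcCalc r x‖ ≤ M * ‖x‖ := by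
  refine (abs_le_of_sq_le_sq' ?_ (by positivity)).2
  rw [mul_pow, norm_sq_eq_sum, norm_sq_eq_sum, Finset.mul_sum]
  refine Finset.sum_le_sum fun m _ => ?_
  rw [inner_eigvec_funcCalc, mul_pow]
  have h := abs_le.1 (hr _ (V.eigval_pos m))
  exact mul_le_mul_of_nonneg_right (sq_le_sq' h.1 h.2) (sq_nonneg _)

theorem euler_pow (k : ℝ) (n : ℕ) (x : V.S) :
    (V.euler k ^ n) x = V.funcCalc (fun l => ((1 + k * l)⁻¹) ^ n) x := by
  induction n with
  | zero =>
    refine V.ext_eigvec fun m => ?_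
    rw [inner_eigvec_funcCalc, pow_zero, pow_zero, one_mul, Module.End.one_apply]
  | succ n ih =>
    rw [pow_succ', Module.End.mul_apply, ih, euler, funcCalc_comp]
    congr 1
    simp only [one_div, pow_succ']

theorem norm_euler_pow_le {k : ℝ} (hk : 0 ≤ k) (n : ℕ) (x : V.S) : ‖(V.euler k ^ n) x‖ ≤ ‖x‖ := by
  rw [euler_pow]
  refine (V.norm_funcCalc_le zero_le_one (fun l hl => ?_) x).trans_eq (one_mul _)
  have hu : 0 ≤ k * l := mul_nonneg hk hl.le
  rw [abs_of_nonneg (by positivity)]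
  exact inv_one_add_pow_le_one hu n

theorem norm_euler_le {k : ℝ} (hk : 0 ≤ k) (x : V.S) : ‖V.euler k x‖ ≤ ‖x‖ := by
  simpa using V.norm_euler_pow_le hk 1 x

theorem norm_euler_pow_sub_le {k : ℝ} (hk : 0 ≤ k) (n : ℕ) (x : V.S) :
    ‖(V.euler k ^ n) (x - V.euler k x)‖ ≤ ‖x‖ / (n + 1) := by
  have h : (V.euler k ^ n) (x - V.euler k x)
      = V.funcCalc (fun l => ((1 + k * l)⁻¹) ^ n * (1 - (1 + k * l)⁻¹)) x := by
    rw [euler_pow]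
    refine V.ext_eigvec fun m => ?_
    simp only [euler, inner_eigvec_funcCalc, inner_sub_right]
    ring
  rw [h, div_eq_inv_mul, ← one_div]
  refine V.norm_funcCalc_le (by positivity) (fun l hl => ?_) x
  have hu : 0 ≤ k * l := mul_nonneg hk hl.le
  rw [abs_of_nonneg (inv_one_add_pow_sub_nonneg hu n)]
  exact inv_one_add_pow_sub_le hu n

theorem euler_discOp {k : ℝ} (hk : 0 ≤ k) (x : V.S) : V.euler k (k • V.discOp x) = x - V.euler k x := by
  refine V.ext_eigvec fun m => ?_
  have h : 1 + k * V.eigval m ≠ 0 := by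
    have := mul_nonneg hk (V.eigval_pos m).le
    positivity
  rw [discOp_eq_funcCalc, map_smul, inner_smul_right, inner_sub_right, euler, funcCalc_comp,
    inner_eigvec_funcCalc, inner_eigvec_funcCalc]
  field_simp
  ring

theorem riesz_form_add {x y : ι → ℝ} (hx : x ∈ E.Hdot 1) (hy : y ∈ E.Hdot 1) :
    (V.riesz fun z => E.form (x + y) (E.coeff z))
      = (V.riesz fun z => E.form x (E.coeff z)) + V.riesz fun z => E.form y (E.coeff z) := by
  refine ext_inner_right ℝ fun z => ?_
  rw [inner_add_left, V.inner_riesz_form hx, V.inner_riesz_form hy,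
    V.inner_riesz_form (add_mem hx hy), E.form_comm, E.form_add (V.coeff_mem z) hx hy,
    E.form_comm, E.form_comm _ y]

theorem ritz_add {x y : ι → ℝ} (hx : x ∈ E.Hdot 1) (hy : y ∈ E.Hdot 1) :
    V.ritz (x + y) = V.ritz x + V.ritz y := by
  rw [ritz, V.riesz_form_add hx hy, map_add, ritz, ritz]

theorem proj_add {x y : ι → ℝ} (hx : x ∈ E.Hdot (-1)) (hy : y ∈ E.Hdot (-1)) :
    V.proj (x + y) = V.proj x + V.proj y := by
  have h := V.riesz_form_add (E.inv_mul_mem hx) (E.inv_mul_mem hy)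
  rw [proj, proj, proj]
  simp only [Eigensystem.pairing]
  rw [← h]
  congr 1
  funext z
  congr 1
  funext i
  simp only [Pi.add_apply, mul_add]

theorem ritz_sub {x y : ι → ℝ} (hx : x ∈ E.Hdot 1) (hy : y ∈ E.Hdot 1) :
    V.ritz (x - y) = V.ritz x - V.ritz y := by
  have h := V.ritz_add (sub_mem hx hy) hy
  rw [sub_add_cancel] at h
  rw [h, add_sub_cancel_right]

theorem proj_sub {x y : ι → ℝ} (hx : x ∈ E.Hdot (-1)) (hy : y ∈ E.Hdot (-1)) :
    V.proj (x - y) = V.proj x - V.proj y := by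
  have h := V.proj_add (sub_mem hx hy) hy
  rw [sub_add_cancel] at h
  rw [h, add_sub_cancel_right]

/-- Pythagoras' theorem for the orthogonal projector. -/
theorem norm_sub_toH_sq {z : ι → ℝ} (hz : z ∈ E.Hdot 0) (y : V.S) :
    ‖(y : H) - E.toH z‖ ^ 2 = ‖y - V.proj z‖ ^ 2 + ‖(V.proj z : H) - E.toH z‖ ^ 2 := by
  have h := V.proj_coeff (E.toH z) (y - V.proj z)
  rw [E.coeff_toH hz] at h
  have h2 : (y : H) - E.toH z = ((y - V.proj z : V.S) : H) + ((V.proj z : H) - E.toH z) := by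
    rw [Submodule.coe_sub]; abel
  have h3 : ⟪((y - V.proj z : V.S) : H), (V.proj z : H) - E.toH z⟫_ℝ = 0 := by
    rw [real_inner_comm, inner_sub_left, h, sub_self]
  rw [h2, norm_add_sq_real, h3, Submodule.coe_norm]
  ring

theorem norm_proj_sub_toH_le {z : ι → ℝ} (hz : z ∈ E.Hdot 0) (y : V.S) :
    ‖(V.proj z : H) - E.toH z‖ ≤ ‖(y : H) - E.toH z‖ := by
  refine (abs_le_of_sq_le_sq' ?_ (norm_nonneg _)).2
  rw [V.norm_sub_toH_sq hz y]
  linarith [sq_nonneg ‖y - V.proj z‖]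

/-- The other leg of the Pythagorean triangle. With `y = R_h z` it bounds `R_h z - P_h z` by the
Ritz error. -/
theorem norm_sub_proj_le {z : ι → ℝ} (hz : z ∈ E.Hdot 0) (y : V.S) :
    ‖y - V.proj z‖ ≤ ‖(y : H) - E.toH z‖ := by
  refine (abs_le_of_sq_le_sq' ?_ (norm_nonneg _)).2
  rw [V.norm_sub_toH_sq hz y]
  linarith [sq_nonneg ‖(V.proj z : H) - E.toH z‖]

theorem norm_proj_le {z : ι → ℝ} (hz : z ∈ E.Hdot 0) : ‖V.proj z‖ ≤ E.hnorm 0 z := by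
  have h := V.norm_sub_proj_le hz 0
  rw [zero_sub, norm_neg, Submodule.coe_zero, zero_sub, norm_neg, E.norm_toH hz] at h
  exact h

/-- This is `P_h A z = A_h R_h z`, tested against `S` and combined with `x = z + k A z`. The
extension of `P_h` to `Ḣ^{-1}` gives it a meaning for `z` merely in `Ḣ^1`. -/
theorem proj_resolvent {k : ℝ} {x z : ι → ℝ} (hx : x ∈ E.Hdot (-1)) (hz : z ∈ E.Hdot 1)
    (h : ∀ i, x i = (1 + k * E.lam i) * z i) :
    V.proj x = V.proj z + k • V.discOp (V.ritz z) := by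
  have hz' := E.Hdot_antitone (show (-1 : ℝ) ≤ 1 by norm_num) hz
  refine ext_inner_right ℝ fun y => ?_
  rw [inner_add_left, real_inner_smul_left, V.discOp_spec, V.ritz_spec hz, V.proj_spec hx,
    V.proj_spec hz', Eigensystem.pairing, Eigensystem.pairing, E.form_comm, E.form_comm _ (E.coeff y),
    E.form_comm z, ← E.form_smul, ← E.form_add (V.coeff_mem y) (E.inv_mul_mem hz')
      (Submodule.smul_mem _ k hz)]
  congr 1
  funext i
  have := (E.lam_pos i).ne'
  simp only [h i, Pi.add_apply, Pi.smul_apply, smul_eq_mul]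
  field_simp

/-- Apply `R(kA_h)` to `proj_resolvent` and use `R(kA_h) k A_h = 1 - R(kA_h)`. -/
theorem euler_proj_sub {k : ℝ} (hk : 0 ≤ k) {x z : ι → ℝ} (hx : x ∈ E.Hdot (-1))
    (hz : z ∈ E.Hdot 1) (h : ∀ i, x i = (1 + k * E.lam i) * z i) :
    V.euler k (V.proj x)
      = V.proj z + ((V.ritz z - V.proj z) - V.euler k (V.ritz z - V.proj z)) := by
  rw [V.proj_resolvent hx hz h, map_add, V.euler_discOp hk, map_sub]
  abel

/-- Stability of the powers of the Euler scheme in the norm of `Ḣ^{-1}`. -/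
theorem norm_euler_pow_proj_le {k : ℝ} (hk : 0 < k) {n : ℕ} (hn : 1 ≤ n) {x : ι → ℝ}
    (hx : x ∈ E.Hdot (-1)) :
    ‖(V.euler k ^ n) (V.proj x)‖ ≤ √(1 / (n * k)) * E.hnorm (-1) x := by
  set v := (V.euler k ^ n) (V.proj x) with hv
  -- Duality: by symmetry `‖v‖²` is the pairing of `x` with `w`, so an `Ḣ^1` bound for `w` in terms
  -- of `‖v‖` suffices.
  set w := (V.euler k ^ n) v with hw
  have hn' : (1 : ℝ) ≤ n := by exact_mod_cast hn
  have h1 : ‖v‖ ^ 2 = E.pairing x (E.coeff w) := by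
    rw [← V.proj_spec hx, ← real_inner_self_eq_norm_sq, hw, euler_pow,
      ← V.funcCalc_symmetric, ← euler_pow]
  have h2 : E.hnorm 1 (E.coeff w) ^ 2 = ⟪V.discOp w, w⟫_ℝ := by
    rw [V.discOp_spec, E.hnorm_sq, Eigensystem.form]
    exact tsum_congr fun i => by rw [Real.rpow_one]; ring
  have h3 : ⟪V.discOp w, w⟫_ℝ ≤ 1 / (n * k) * ‖v‖ ^ 2 := by
    have e : ⟪V.discOp w, w⟫_ℝ = ⟪V.funcCalc
        (fun l => ((1 + k * l)⁻¹) ^ n * l * ((1 + k * l)⁻¹) ^ n) v, v⟫_ℝ := by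
      conv_lhs => rw [discOp_eq_funcCalc, hw, euler_pow, ← V.funcCalc_symmetric,
        funcCalc_comp, funcCalc_comp]
    rw [e]
    refine (real_inner_le_norm _ _).trans ?_
    rw [sq, ← mul_assoc]
    refine mul_le_mul_of_nonneg_right ?_ (norm_nonneg _)
    refine V.norm_funcCalc_le (by positivity) (fun l hl => ?_) v
    have hu : 0 ≤ k * l := by positivity
    rw [abs_of_nonneg (by positivity), le_div_iff₀ (by positivity)]
    have a1 := inv_one_add_pow_mul_le hu n
    have a2 := inv_one_add_pow_le_one hu n
    calc _ = ((1 + k * l)⁻¹) ^ n * (((1 + k * l)⁻¹) ^ n * (n * (k * l))) := by ring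
      _ ≤ 1 := mul_le_one₀ a2 (by positivity) a1
  have h4 : E.hnorm 1 (E.coeff w) ≤ √(1 / (n * k)) * ‖v‖ := by
    refine (abs_le_of_sq_le_sq' ?_ (by positivity)).2
    rw [h2, mul_pow, Real.sq_sqrt (by positivity)]
    exact h3
  have h5 : ‖v‖ * ‖v‖ ≤ √(1 / (n * k)) * E.hnorm (-1) x * ‖v‖ := by
    rw [← sq, h1]
    refine (le_abs_self _).trans ((E.abs_pairing_le hx (V.coeff_mem w)).trans ?_)
    calc _ ≤ E.hnorm (-1) x * (√(1 / (n * k)) * ‖v‖) :=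
          mul_le_mul_of_nonneg_left h4 (E.hnorm_nonneg _ _)
      _ = _ := by ring
  rcases (norm_nonneg v).eq_or_lt with h0 | h0
  · rw [← h0]
    exact mul_nonneg (Real.sqrt_nonneg _) (E.hnorm_nonneg _ _)
  · exact le_of_mul_le_mul_right h5 h0

end GalerkinSpace

end Galerkin

namespace Galerkin

/-! ### The spatial error against backward Euler for `A`. -/

namespace Eigensystem

variable {H : Type*} [NormedAddCommGroup H] [InnerProductSpace ℝ H] [CompleteSpace H]
  {A : EllipticOperator H} {ι : Type*} (E : Eigensystem A ι)

/-- The multiplier `(1 + k λᵢ)⁻¹` of the backward Euler scheme for `A`. -/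
noncomputable def eulerMult (k : ℝ) (i : ι) : ℝ := (1 + k * E.lam i)⁻¹

variable {E}

theorem eulerMult_nonneg {k : ℝ} (hk : 0 ≤ k) (i : ι) : 0 ≤ E.eulerMult k i := by
  have := mul_nonneg hk (E.lam_pos i).le
  unfold eulerMult
  positivity

theorem eulerMult_pow_le_one {k : ℝ} (hk : 0 ≤ k) (n : ℕ) (i : ι) : E.eulerMult k i ^ n ≤ 1 :=
  inv_one_add_pow_le_one (mul_nonneg hk (E.lam_pos i).le) n

theorem eulerMult_pow_sub_nonneg {k : ℝ} (hk : 0 ≤ k) (n : ℕ) (i : ι) :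
    0 ≤ E.eulerMult k i ^ n * (1 - E.eulerMult k i) :=
  inv_one_add_pow_sub_nonneg (mul_nonneg hk (E.lam_pos i).le) n

theorem eulerMult_pow_sub_le {k : ℝ} (hk : 0 ≤ k) (n : ℕ) (i : ι) :
    E.eulerMult k i ^ n * (1 - E.eulerMult k i) ≤ 1 / (n + 1) :=
  inv_one_add_pow_sub_le (mul_nonneg hk (E.lam_pos i).le) n

theorem eulerMult_pow_mul_le {k : ℝ} (hk : 0 ≤ k) (n : ℕ) (i : ι) :
    E.eulerMult k i ^ n * (n * (k * E.lam i)) ≤ 1 :=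
  inv_one_add_pow_mul_le (mul_nonneg hk (E.lam_pos i).le) n

theorem one_sub_eulerMult {k : ℝ} (hk : 0 ≤ k) (i : ι) :
    1 - E.eulerMult k i = k * E.lam i * E.eulerMult k i := by
  have : 1 + k * E.lam i ≠ 0 := by
    have := mul_nonneg hk (E.lam_pos i).le
    positivity
  unfold eulerMult
  field_simp
  ring

variable (E)

/-- A multiplier of size `M / λᵢ` gains two orders of smoothness. -/
theorem mul_mem_and_hnorm_le_gain (s : ℝ) {M : ℝ} {g x : ι → ℝ} (hM : 0 ≤ M)
    (hx : x ∈ E.Hdot (s - 2)) (h : ∀ i, |g i| * E.lam i ≤ M) :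
    (fun i => g i * x i) ∈ E.Hdot s ∧ E.hnorm s (fun i => g i * x i) ≤ M * E.hnorm (s - 2) x := by
  refine E.mul_mem_and_hnorm_le hM hx fun i => ?_
  have hl := E.lam_pos i
  have h1 : (|g i| * E.lam i) ^ 2 ≤ M ^ 2 := pow_le_pow_left₀ (by positivity) (h i) 2
  have h2 : E.lam i ^ s = E.lam i ^ (s - 2) * E.lam i ^ 2 := by
    rw [← Real.rpow_natCast, ← Real.rpow_add hl]
    norm_num
  rw [mul_pow, sq_abs] at h1
  rw [h2]
  nlinarith [Real.rpow_nonneg hl.le (s - 2)]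

end Eigensystem

namespace GalerkinSpace

variable {H : Type*} [NormedAddCommGroup H] [InnerProductSpace ℝ H] [CompleteSpace H]
  {A : EllipticOperator H} {ι : Type*} {E : Eigensystem A ι} (V : GalerkinSpace E)

/-- The difference `R_h z - P_h z` of the two projections. -/
noncomputable def projDiff (z : ι → ℝ) : V.S := V.ritz z - V.proj z

theorem projDiff_sub {x y : ι → ℝ} (hx : x ∈ E.Hdot 1) (hy : y ∈ E.Hdot 1) :
    V.projDiff x - V.projDiff y = V.projDiff (x - y) := by
  have h : (-1 : ℝ) ≤ 1 := by norm_num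
  rw [projDiff, projDiff, projDiff, V.ritz_sub hx hy,
    V.proj_sub (E.Hdot_antitone h hx) (E.Hdot_antitone h hy)]
  abel

/-- The spatial part of the error as a discrete Duhamel sum. -/
theorem euler_pow_proj_sub {k : ℝ} (hk : 0 < k) {x : ι → ℝ} (hx : x ∈ E.Hdot (-1)) (n : ℕ) :
    (V.euler k ^ n) (V.proj x) - V.proj (fun i => E.eulerMult k i ^ n * x i)
      = duhamel (V.euler k)
          (fun j => V.projDiff fun i => E.eulerMult k i ^ (j + 1) * x i) n := by
  induction n with
  | zero => simp [duhamel]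
  | succ n ih =>
    have h1 : (fun i => E.eulerMult k i ^ n * x i) ∈ E.Hdot (-1) :=
      (E.mul_mem_and_hnorm_le_same (-1) zero_le_one hx fun i => by
        rw [abs_of_nonneg (pow_nonneg (Eigensystem.eulerMult_nonneg hk.le i) n)]
        exact Eigensystem.eulerMult_pow_le_one hk.le n i).1
    -- One resolvent already lifts `Ḣ^{-1}` to `Ḣ^1`, where the Ritz projector is defined; hence the
    -- exponent `j + 1` in the summands.
    have h2 : (fun i => E.eulerMult k i ^ (n + 1) * x i) ∈ E.Hdot 1 := by
      refine (E.mul_mem_and_hnorm_le_gain 1 (M := 1 / ((n + 1 : ℕ) * k)) (by positivity)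
        (by norm_num; exact hx) fun i => ?_).1
      rw [abs_of_nonneg (pow_nonneg (Eigensystem.eulerMult_nonneg hk.le i) _),
        le_div_iff₀ (by positivity)]
      have := Eigensystem.eulerMult_pow_mul_le (E := E) hk.le (n + 1) i
      linarith
    have h3 := V.euler_proj_sub hk.le h1 h2 fun i => by
      have : 1 + k * E.lam i ≠ 0 := by
        have := mul_nonneg hk.le (E.lam_pos i).le
        positivity
      rw [pow_succ, Eigensystem.eulerMult]
      field_simp
    rw [duhamel, ← ih, pow_succ', Module.End.mul_apply, map_sub, h3, projDiff]
    abel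

theorem norm_projDiff_le {s η : ℝ} (hs : 1 ≤ s)
    (hV : ∀ x ∈ E.Hdot s, ‖(V.ritz x : H) - E.toH x‖ ≤ η * E.hnorm s x) {z : ι → ℝ}
    (hz : z ∈ E.Hdot s) : ‖V.projDiff z‖ ≤ η * E.hnorm s z :=
  (V.norm_sub_proj_le (E.Hdot_antitone (by linarith) hz) _).trans (hV z hz)

theorem norm_proj_sub_le {s η : ℝ} (hs : 1 ≤ s)
    (hV : ∀ x ∈ E.Hdot s, ‖(V.ritz x : H) - E.toH x‖ ≤ η * E.hnorm s x) {z : ι → ℝ}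
    (hz : z ∈ E.Hdot s) : ‖(V.proj z : H) - E.toH z‖ ≤ η * E.hnorm s z :=
  (V.norm_proj_sub_toH_le (E.Hdot_antitone (by linarith) hz) _).trans (hV z hz)

/-- Spatial error for smooth data. -/
theorem norm_spatial_error_le {s η : ℝ} (hs : 1 ≤ s) (hη : 0 ≤ η)
    (hV : ∀ x ∈ E.Hdot s, ‖(V.ritz x : H) - E.toH x‖ ≤ η * E.hnorm s x)
    {k : ℝ} (hk : 0 < k) {x : ι → ℝ} (hx : x ∈ E.Hdot s) (n : ℕ) :
    ‖((V.euler k ^ n) (V.proj x) : H) - E.toH (fun i => E.eulerMult k i ^ n * x i)‖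
      ≤ 5 * η * E.hnorm s x := by
  have hX := E.hnorm_nonneg s x
  have hb : ∀ j, (fun i => E.eulerMult k i ^ j * x i) ∈ E.Hdot s ∧
      E.hnorm s (fun i => E.eulerMult k i ^ j * x i) ≤ 1 * E.hnorm s x := fun j =>
    E.mul_mem_and_hnorm_le_same s zero_le_one hx fun i => by
      rw [abs_of_nonneg (pow_nonneg (Eigensystem.eulerMult_nonneg hk.le i) j)]
      exact Eigensystem.eulerMult_pow_le_one hk.le j i
  have h1 := V.euler_pow_proj_sub hk (E.Hdot_antitone (by linarith) hx) n
  have h2 : ‖(V.euler k ^ n) (V.proj x) - V.proj (fun i => E.eulerMult k i ^ n * x i)‖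
      ≤ 4 * (η * E.hnorm s x) := by
    rw [h1]
    refine norm_duhamel_le (V.norm_euler_le hk.le) (V.norm_euler_pow_sub_le hk.le)
      (by positivity) (fun j => ?_) (fun j => ?_) n
    · refine (V.norm_projDiff_le hs hV (hb _).1).trans ?_
      exact mul_le_mul_of_nonneg_left ((hb _).2.trans_eq (one_mul _)) hη
    · rw [V.projDiff_sub (E.Hdot_antitone hs (hb _).1) (E.Hdot_antitone hs (hb _).1)]
      have e : ((fun i => E.eulerMult k i ^ (j + 1) * x i)
          - fun i => E.eulerMult k i ^ (j + 1 + 1) * x i)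
          = fun i => (E.eulerMult k i ^ (j + 1) * (1 - E.eulerMult k i)) * x i := by
        funext i
        simp only [Pi.sub_apply]
        ring
      have hd := E.mul_mem_and_hnorm_le_same s (M := 1 / (j + 1))
        (g := fun i => E.eulerMult k i ^ (j + 1) * (1 - E.eulerMult k i)) (by positivity) hx
        fun i => by
          rw [abs_of_nonneg (Eigensystem.eulerMult_pow_sub_nonneg hk.le _ i)]
          refine (Eigensystem.eulerMult_pow_sub_le hk.le _ i).trans ?_
          gcongr
          linarith
      rw [e]
      refine (V.norm_projDiff_le hs hV hd.1).trans
        ((mul_le_mul_of_nonneg_left hd.2 hη).trans_eq ?_)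
      ring
  have h3 := V.norm_proj_sub_le hs hV (hb n).1
  have h4 := mul_le_mul_of_nonneg_left (hb n).2 hη
  rw [Submodule.coe_norm, Submodule.coe_sub] at h2
  refine (norm_sub_le_norm_sub_add_norm_sub _
    (V.proj (fun i => E.eulerMult k i ^ n * x i) : H) _).trans ?_
  linarith

/-- Spatial error for nonsmooth data. -/
theorem norm_spatial_error_le_of_nonsmooth {s η : ℝ} (hs : 1 ≤ s) (hη : 0 ≤ η)
    (hV : ∀ x ∈ E.Hdot s, ‖(V.ritz x : H) - E.toH x‖ ≤ η * E.hnorm s x)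
    {k : ℝ} (hk : 0 < k) {x : ι → ℝ}
    (hx : x ∈ E.Hdot (s - 2)) {n : ℕ} (hn : 1 ≤ n) :
    ‖((V.euler k ^ n) (V.proj x) : H) - E.toH (fun i => E.eulerMult k i ^ n * x i)‖
      ≤ 21 * η / (n * k) * E.hnorm (s - 2) x := by
  have hX := E.hnorm_nonneg (s - 2) x
  have hn' : (1 : ℝ) ≤ n := by exact_mod_cast hn
  have hgain : ∀ (G : ι → ℝ) (M : ℝ), 0 ≤ M → (∀ i, 0 ≤ G i) → (∀ i, G i ≤ M) →
      (fun i => (k * E.lam i)⁻¹ * G i * x i) ∈ E.Hdot s ∧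
        ‖V.projDiff (fun i => (k * E.lam i)⁻¹ * G i * x i)‖
          ≤ η * E.hnorm (s - 2) x / k * M := by
    intro G M hM hG hGM
    have h := E.mul_mem_and_hnorm_le_gain s (g := fun i => (k * E.lam i)⁻¹ * G i) (M := M / k)
      (by positivity) hx fun i => by
        have hl := E.lam_pos i
        rw [abs_of_nonneg (mul_nonneg (by positivity) (hG i)), le_div_iff₀ hk]
        have : (k * E.lam i)⁻¹ * G i * E.lam i * k = G i := by field_simp
        rw [this]
        exact hGM i
    refine ⟨h.1, (V.norm_projDiff_le hs hV h.1).trans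
      ((mul_le_mul_of_nonneg_left h.2 hη).trans_eq ?_)⟩
    ring
  -- Because `R(kA)^(j+1) = (kA)⁻¹ R(kA)^j (1 - R(kA))`, the Duhamel data are the differences of
  -- `w`. The factor `(kA)⁻¹` gains the two missing orders of smoothness at the price `1 / k`.
  let w : ℕ → V.S := fun j => V.projDiff fun i => (k * E.lam i)⁻¹ * E.eulerMult k i ^ j * x i
  have hpow : ∀ j i, 0 ≤ E.eulerMult k i ^ j := fun j i =>
    pow_nonneg (Eigensystem.eulerMult_nonneg hk.le i) j
  have hw0 := fun j => hgain (fun i => E.eulerMult k i ^ j) 1 zero_le_one (hpow j)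
    (Eigensystem.eulerMult_pow_le_one hk.le j)
  have hsub : ∀ j, w j - w (j + 1)
      = V.projDiff fun i => (k * E.lam i)⁻¹ *
          (E.eulerMult k i ^ j * (1 - E.eulerMult k i)) * x i := by
    intro j
    simp only [w]
    rw [V.projDiff_sub (E.Hdot_antitone hs (hw0 _).1) (E.Hdot_antitone hs (hw0 _).1)]
    congr 1
    funext i
    simp only [Pi.sub_apply]
    ring
  have hw1 := fun j : ℕ => hgain (fun i => E.eulerMult k i ^ j * (1 - E.eulerMult k i))
    (1 / (j + 1)) (by positivity) (Eigensystem.eulerMult_pow_sub_nonneg hk.le j)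
    (Eigensystem.eulerMult_pow_sub_le hk.le j)
  -- The second difference holds two factors `1 - R(kA)`; one is paired with each of the powers `m`
  -- and `j`, giving `1 / (m + 1)` times `1 / (j + 1)`.
  have hsub2 : ∀ m j, (w (m + j) - w (m + j + 1)) - (w (m + j + 1) - w (m + j + 2))
      = V.projDiff fun i => (k * E.lam i)⁻¹ *
          ((E.eulerMult k i ^ m * (1 - E.eulerMult k i)) *
            (E.eulerMult k i ^ j * (1 - E.eulerMult k i))) * x i := by
    intro m j
    rw [hsub, hsub (m + j + 1),
      V.projDiff_sub (E.Hdot_antitone hs (hw1 _).1) (E.Hdot_antitone hs (hw1 _).1)]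
    congr 1
    funext i
    simp only [Pi.sub_apply]
    ring
  have hw2 := fun m j : ℕ => hgain (fun i => (E.eulerMult k i ^ m * (1 - E.eulerMult k i)) *
      (E.eulerMult k i ^ j * (1 - E.eulerMult k i)))
    (1 / (m + 1) * (1 / (j + 1))) (by positivity)
    (fun i => mul_nonneg (Eigensystem.eulerMult_pow_sub_nonneg hk.le m i)
      (Eigensystem.eulerMult_pow_sub_nonneg hk.le j i))
    (fun i => mul_le_mul (Eigensystem.eulerMult_pow_sub_le hk.le m i)
      (Eigensystem.eulerMult_pow_sub_le hk.le j i)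
      (Eigensystem.eulerMult_pow_sub_nonneg hk.le j i) (by positivity))
  have h1 := V.euler_pow_proj_sub hk (E.Hdot_antitone (by linarith) hx) n
  have hy : (fun j => V.projDiff fun i => E.eulerMult k i ^ (j + 1) * x i)
      = fun j => w j - w (j + 1) := by
    funext j
    rw [hsub]
    congr 1
    funext i
    have hl := E.lam_pos i
    rw [Eigensystem.one_sub_eulerMult hk.le, pow_succ]
    field_simp
  have h2 : ‖(V.euler k ^ n) (V.proj x) - V.proj (fun i => E.eulerMult k i ^ n * x i)‖
      ≤ 20 * (η * E.hnorm (s - 2) x / k) / (n + 1) := by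
    rw [h1, hy]
    refine norm_duhamel_sub_shift_le (V.norm_euler_le hk.le) (V.norm_euler_pow_sub_le hk.le)
      (by positivity) (fun j => ?_) (fun j => ?_) (fun m j => ?_) n
    · exact (hw0 j).2.trans_eq (mul_one _)
    · rw [hsub]
      exact (hw1 j).2.trans_eq (by ring)
    · rw [hsub2]
      exact (hw2 m j).2.trans_eq (by ring)
  have hb := E.mul_mem_and_hnorm_le_gain s (g := fun i => E.eulerMult k i ^ n)
    (M := 1 / (n * k)) (by positivity) hx fun i => by
      rw [abs_of_nonneg (hpow n i), le_div_iff₀ (by positivity)]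
      have := Eigensystem.eulerMult_pow_mul_le (E := E) hk.le n i
      linarith
  have h3 := V.norm_proj_sub_le hs hV hb.1
  have h4 := mul_le_mul_of_nonneg_left hb.2 hη
  have h5 : 20 * (η * E.hnorm (s - 2) x / k) / (n + 1)
      ≤ 20 * (η * E.hnorm (s - 2) x / k) / n := by
    gcongr
    linarith
  have h6 : 20 * (η * E.hnorm (s - 2) x / k) / n + η * (1 / (n * k) * E.hnorm (s - 2) x)
      = 21 * η / (n * k) * E.hnorm (s - 2) x := by
    field_simp
    ring
  rw [Submodule.coe_norm, Submodule.coe_sub] at h2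
  refine (norm_sub_le_norm_sub_add_norm_sub _
    (V.proj (fun i => E.eulerMult k i ^ n * x i) : H) _).trans ?_
  linarith

end GalerkinSpace

end Galerkin

namespace Galerkin

/-! ### The error operator and its endpoint estimates. -/

namespace Eigensystem

variable {H : Type*} [NormedAddCommGroup H] [InnerProductSpace ℝ H] [CompleteSpace H]
  {A : EllipticOperator H} {ι : Type*} (E : Eigensystem A ι)

theorem exp_mul_mem {t : ℝ} (ht : 0 < t) {x : ι → ℝ} (hx : x ∈ E.Hdot (-1)) :
    (fun i => Real.exp (-(E.lam i * t)) * x i) ∈ E.Hdot 0 ∧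
      E.hnorm 0 (fun i => Real.exp (-(E.lam i * t)) * x i) ≤ √(1 / t) * E.hnorm (-1) x := by
  refine E.mul_mem_and_hnorm_le (Real.sqrt_nonneg _) hx fun i => ?_
  have hl := E.lam_pos i
  have h1 : Real.exp (-(E.lam i * t)) * (E.lam i * t) ≤ 1 := exp_neg_mul_le
  have h2 : Real.exp (-(E.lam i * t)) ≤ 1 := Real.exp_le_one_iff.2 (by nlinarith)
  have h3 := Real.exp_pos (-(E.lam i * t))
  rw [Real.rpow_zero, Real.rpow_neg_one, Real.sq_sqrt (by positivity), one_mul, one_div,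
    ← mul_inv, ← one_div, le_div_iff₀ (by positivity)]
  calc _ = Real.exp (-(E.lam i * t)) * (Real.exp (-(E.lam i * t)) * (E.lam i * t)) := by ring
    _ ≤ 1 := mul_le_one₀ h2 (by positivity) h1

theorem norm_semigroup_le {t : ℝ} (ht : 0 < t) {x : ι → ℝ} (hx : x ∈ E.Hdot (-1)) :
    ‖E.semigroup t x‖ ≤ √(1 / t) * E.hnorm (-1) x := by
  have h := E.exp_mul_mem ht hx
  rw [semigroup, E.norm_toH h.1]
  exact h.2

theorem norm_semigroup_le_of_mem {t : ℝ} (ht : 0 < t) {x : ι → ℝ} (hx : x ∈ E.Hdot 0) :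
    ‖E.semigroup t x‖ ≤ E.hnorm 0 x := by
  have h := E.mul_mem_and_hnorm_le_same 0 (g := fun i => Real.exp (-(E.lam i * t)))
    zero_le_one hx fun i => by
      have hl := E.lam_pos i
      rw [abs_of_pos (Real.exp_pos _)]
      exact Real.exp_le_one_iff.2 (by nlinarith)
  rw [semigroup, E.norm_toH h.1]
  exact h.2.trans_eq (one_mul _)

end Eigensystem

namespace GalerkinSpace

variable {H : Type*} [NormedAddCommGroup H] [InnerProductSpace ℝ H] [CompleteSpace H]
  {A : EllipticOperator H} {ι : Type*} {E : Eigensystem A ι} (V : GalerkinSpace E)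

theorem error_add {k t : ℝ} (ht : 0 < t) {x y : ι → ℝ} (hx : x ∈ E.Hdot (-1))
    (hy : y ∈ E.Hdot (-1)) : V.error k t (x + y) = V.error k t x + V.error k t y := by
  have h : E.semigroup t (x + y) = E.semigroup t x + E.semigroup t y := by
    rw [Eigensystem.semigroup, Eigensystem.semigroup, Eigensystem.semigroup,
      ← E.toH_add (E.exp_mul_mem ht hx).1 (E.exp_mul_mem ht hy).1]
    congr 1
    funext i
    simp only [Pi.add_apply, mul_add]
  rw [error, error, error, V.proj_add hx hy, map_add, Submodule.coe_add, h]
  abel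

theorem norm_error_le_two {k t : ℝ} (hk : 0 ≤ k) (ht : 0 < t) {x : ι → ℝ} (hx : x ∈ E.Hdot 0) :
    ‖V.error k t x‖ ≤ 2 * E.hnorm 0 x := by
  refine (norm_sub_le _ _).trans ?_
  have h1 := (V.norm_euler_pow_le hk (⌊t / k⌋₊ + 1) (V.proj x)).trans (V.norm_proj_le hx)
  have h2 := E.norm_semigroup_le_of_mem ht hx
  rw [Submodule.coe_norm] at h1
  rw [fullyDiscrete]
  linarith

theorem lt_floor_succ_mul {k t : ℝ} (hk : 0 < k) : t < ((⌊t / k⌋₊ + 1 : ℕ) : ℝ) * k := by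
  rw [← div_lt_iff₀ hk]
  exact_mod_cast Nat.lt_floor_add_one (t / k)

/-- Both terms are smoothing on their own; the discrete one acts at the grid time `n * k`, which
exceeds `t`. -/
theorem norm_error_le_neg_one {k t : ℝ} (hk : 0 < k) (ht : 0 < t) {x : ι → ℝ}
    (hx : x ∈ E.Hdot (-1)) :
    ‖V.error k t x‖ ≤ 2 * √(1 / t) * E.hnorm (-1) x := by
  refine (norm_sub_le _ _).trans ?_
  have h1 := V.norm_euler_pow_proj_le hk (Nat.le_add_left 1 ⌊t / k⌋₊) hx
  have h2 := E.norm_semigroup_le ht hx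
  have h3 : √(1 / (((⌊t / k⌋₊ + 1 : ℕ) : ℝ) * k)) ≤ √(1 / t) :=
    Real.sqrt_le_sqrt (one_div_le_one_div_of_le ht (lt_floor_succ_mul hk).le)
  have h4 := mul_le_mul_of_nonneg_right h3 (E.hnorm_nonneg (-1) x)
  rw [Submodule.coe_norm] at h1
  rw [fullyDiscrete]
  linarith

/-- Splitting of the error into its spatial and temporal parts. -/
theorem norm_error_le_add {k t : ℝ} (ht : 0 < t) {r a M : ℝ} (hr : -1 ≤ r)
    (hM : 0 ≤ M) {x : ι → ℝ} (hx : x ∈ E.Hdot r)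
    (ha : ‖((V.euler k ^ (⌊t / k⌋₊ + 1)) (V.proj x) : H)
      - E.toH (fun i => E.eulerMult k i ^ (⌊t / k⌋₊ + 1) * x i)‖ ≤ a)
    (hg : ∀ i, (E.eulerMult k i ^ (⌊t / k⌋₊ + 1) - Real.exp (-(E.lam i * t))) ^ 2
      ≤ M ^ 2 * E.lam i ^ r) :
    ‖V.error k t x‖ ≤ a + M * E.hnorm r x := by
  have hx' := E.Hdot_antitone hr hx
  have h1 := E.mul_mem_and_hnorm_le (s := 0)
    (g := fun i => E.eulerMult k i ^ (⌊t / k⌋₊ + 1) - Real.exp (-(E.lam i * t))) hM hx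
    fun i => by rw [Real.rpow_zero, one_mul]; exact hg i
  have h2 := (E.exp_mul_mem ht hx').1
  have h3 := E.toH_add h1.1 h2
  have h4 : ((fun i => (E.eulerMult k i ^ (⌊t / k⌋₊ + 1) - Real.exp (-(E.lam i * t))) * x i)
      + fun i => Real.exp (-(E.lam i * t)) * x i)
      = fun i => E.eulerMult k i ^ (⌊t / k⌋₊ + 1) * x i := by
    funext i
    simp only [Pi.add_apply]
    ring
  rw [h4] at h3
  have h5 := h1.2
  rw [← E.norm_toH h1.1] at h5
  refine le_trans (le_of_eq ?_) ((norm_add_le _ _).trans (add_le_add ha h5))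
  rw [h3, error, fullyDiscrete, Eigensystem.semigroup]
  congr 1
  abel

/-- The temporal error of a single mode, in the three forms that are used. -/
theorem temporal_error {k t : ℝ} (hk : 0 < k) (ht : 0 < t) (i : ι) :
    |E.eulerMult k i ^ (⌊t / k⌋₊ + 1) - Real.exp (-(E.lam i * t))| ≤ k * E.lam i ∧
    |E.eulerMult k i ^ (⌊t / k⌋₊ + 1) - Real.exp (-(E.lam i * t))| * t ≤ 6 * k ∧
    |E.eulerMult k i ^ (⌊t / k⌋₊ + 1) - Real.exp (-(E.lam i * t))| * (t * E.lam i) ≤ 1 := by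
  have hu : 0 ≤ k * E.lam i := mul_nonneg hk.le (E.lam_pos i).le
  have hτ : 0 ≤ t / k := by positivity
  have h2 : t / k ≤ ((⌊t / k⌋₊ + 1 : ℕ) : ℝ) := by
    rw [div_le_iff₀ hk]
    exact (lt_floor_succ_mul hk).le
  have h1 : ((⌊t / k⌋₊ + 1 : ℕ) : ℝ) ≤ t / k + 1 := by
    push_cast
    linarith [Nat.floor_le hτ]
  have e : t / k * (k * E.lam i) = E.lam i * t := by field_simp
  have a := abs_euler_sub_exp_le hu hτ h2 h1
  have b := abs_euler_sub_exp_mul_le hu hτ h2 h1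
  have c := abs_euler_sub_exp_mul_mul_le hu hτ h2
  rw [e] at a b c
  refine ⟨a, ?_, ?_⟩
  · rwa [← mul_div_assoc, div_le_iff₀ hk] at b
  · rwa [mul_comm t]

theorem norm_error_le_of_smooth {η : ℝ} (hη : 0 ≤ η)
    (hV : ∀ x ∈ E.Hdot 2, ‖(V.ritz x : H) - E.toH x‖ ≤ η * E.hnorm 2 x)
    {k t : ℝ} (hk : 0 < k) (ht : 0 < t) {x : ι → ℝ} (hx : x ∈ E.Hdot 2) :
    ‖V.error k t x‖ ≤ (5 * η + k) * E.hnorm 2 x := by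
  rw [add_mul]
  refine V.norm_error_le_add ht (by norm_num) hk.le hx
    (V.norm_spatial_error_le one_le_two hη hV hk hx _) fun i => ?_
  have h := (temporal_error (E := E) hk ht i).1
  have := sq_le_sq' (abs_le.1 h).1 (abs_le.1 h).2
  rw [Real.rpow_two]
  linarith [mul_pow k (E.lam i) 2]

theorem norm_spatial_error_le_div {s η : ℝ} (hs : 1 ≤ s) (hη : 0 ≤ η)
    (hV : ∀ x ∈ E.Hdot s, ‖(V.ritz x : H) - E.toH x‖ ≤ η * E.hnorm s x)
    {k t : ℝ} (hk : 0 < k) (ht : 0 < t) {x : ι → ℝ} (hx : x ∈ E.Hdot (s - 2)) :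
    ‖((V.euler k ^ (⌊t / k⌋₊ + 1)) (V.proj x) : H)
      - E.toH (fun i => E.eulerMult k i ^ (⌊t / k⌋₊ + 1) * x i)‖
      ≤ 21 * η / t * E.hnorm (s - 2) x := by
  refine (V.norm_spatial_error_le_of_nonsmooth hs hη hV hk hx (Nat.le_add_left 1 _)).trans ?_
  refine mul_le_mul_of_nonneg_right ?_ (E.hnorm_nonneg _ _)
  exact div_le_div_of_nonneg_left (by positivity) ht (lt_floor_succ_mul hk).le

theorem norm_error_le_of_nonsmooth {η : ℝ} (hη : 0 ≤ η)
    (hV : ∀ x ∈ E.Hdot 2, ‖(V.ritz x : H) - E.toH x‖ ≤ η * E.hnorm 2 x)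
    {k t : ℝ} (hk : 0 < k) (ht : 0 < t) {x : ι → ℝ} (hx : x ∈ E.Hdot 0) :
    ‖V.error k t x‖ ≤ (21 * η + 6 * k) / t * E.hnorm 0 x := by
  have e : (2 : ℝ) - 2 = 0 := by norm_num
  have h := V.norm_spatial_error_le_div one_le_two hη hV hk ht (by rwa [e])
  rw [e] at h
  rw [add_div, add_mul]
  refine V.norm_error_le_add ht (by norm_num) (by positivity) hx h fun i => ?_
  have h := (temporal_error (E := E) hk ht i).2.1
  rw [← le_div_iff₀ ht] at h
  have := sq_le_sq' (abs_le.1 h).1 (abs_le.1 h).2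
  rwa [Real.rpow_zero, mul_one]

theorem norm_error_le_of_rough {η : ℝ} (hη : 0 ≤ η)
    (hV : ∀ x ∈ E.Hdot 1, ‖(V.ritz x : H) - E.toH x‖ ≤ η * E.hnorm 1 x)
    {k t : ℝ} (hk : 0 < k) (ht : 0 < t) {x : ι → ℝ} (hx : x ∈ E.Hdot (-1)) :
    ‖V.error k t x‖ ≤ (21 * η + 6 * √k) / t * E.hnorm (-1) x := by
  have e : (1 : ℝ) - 2 = -1 := by norm_num
  have h := V.norm_spatial_error_le_div le_rfl hη hV hk ht (by rwa [e])
  rw [e] at h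
  rw [add_div, add_mul]
  refine V.norm_error_le_add ht le_rfl (by positivity) hx h fun i => ?_
  have hl := E.lam_pos i
  obtain ⟨-, h1, h2⟩ := temporal_error (E := E) hk ht i
  -- The squared symbol is bounded by the product of the first-order bound `6k / t` and the
  -- smoothing bound `1 / (tλ)`; this is the source of `√k` and of the weight `λ⁻¹`.
  have h3 := mul_le_mul h1 h2 (by positivity) (by positivity)
  rw [Real.rpow_neg_one, div_pow, mul_pow, Real.sq_sqrt hk.le, ← div_eq_mul_inv, div_div,
    le_div_iff₀ (by positivity), ← sq_abs]
  nlinarith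

end GalerkinSpace

theorem add_rpow_le_rpow_add_rpow_half {h k μ : ℝ} (hh : 0 < h) (hk : 0 < k) (h0 : 0 ≤ μ)
    (h2 : μ ≤ 2) : (h ^ 2 + k) ^ (μ / 2) ≤ h ^ μ + k ^ (μ / 2) := by
  refine (Real.rpow_add_le_add_rpow (by positivity) hk.le (by linarith) (by linarith)).trans_eq ?_
  rw [← Real.rpow_natCast, ← Real.rpow_mul hh.le]
  congr 2
  push_cast
  ring

/-- The approximation property with a nonnegative constant, for `s = 1` and `s = 2`. -/
theorem ApproximationProperty.exists_nonneg {H : Type*} [NormedAddCommGroup H]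
    [InnerProductSpace ℝ H] [CompleteSpace H] {A : EllipticOperator H} {ι : Type*}
    {E : Eigensystem A ι} {V : Set.Ioc (0 : ℝ) 1 → GalerkinSpace E}
    (hV : ApproximationProperty V) : ∃ C : ℝ, 0 ≤ C ∧ ∀ h : Set.Ioc (0 : ℝ) 1,
      (∀ x ∈ E.Hdot 1, ‖((V h).ritz x : H) - E.toH x‖ ≤ C * (h : ℝ) * E.hnorm 1 x) ∧
      ∀ x ∈ E.Hdot 2, ‖((V h).ritz x : H) - E.toH x‖ ≤ C * (h : ℝ) ^ 2 * E.hnorm 2 x := by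
  obtain ⟨C, hC⟩ := hV
  have key : ∀ s ∈ ({1, 2} : Set ℝ), ∀ h : Set.Ioc (0 : ℝ) 1, ∀ x ∈ E.Hdot s,
      ‖((V h).ritz x : H) - E.toH x‖ ≤ |C| * (h : ℝ) ^ s * E.hnorm s x := by
    intro s hs h x hx
    refine (hC s hs h x hx).trans ?_
    have := Real.rpow_nonneg h.2.1.le s
    exact mul_le_mul_of_nonneg_right (mul_le_mul_of_nonneg_right (le_abs_self C) this)
      (E.hnorm_nonneg _ _)
  refine ⟨|C|, abs_nonneg C, fun h => ⟨fun x hx => ?_, fun x hx => ?_⟩⟩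
  · simpa using key 1 (by simp) h x hx
  · simpa using key 2 (by simp) h x hx

/-! ### Interpolation between the endpoint estimates. -/

section Main

variable {H : Type*} [NormedAddCommGroup H] [InnerProductSpace ℝ H] [CompleteSpace H]
  {A : EllipticOperator H} {ι : Type*} {E : Eigensystem A ι} (V : GalerkinSpace E)
  {C h k t : ℝ}

/-- On `H` the error is bounded by a constant and by `δ / t`, hence by `(δ / t) ^ α` for every `α ∈
[0, 1]`. This is interpolated with the bound `δ` on `Ḣ^2`, and `α` is fixed by the required power of
`t`. -/
theorem GalerkinSpace.norm_error_le_interpolated (hC : 0 ≤ C) (hh : 0 < h) (hk : 0 < k)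
    (hV : ∀ x ∈ E.Hdot 2, ‖(V.ritz x : H) - E.toH x‖ ≤ C * h ^ 2 * E.hnorm 2 x)
    (ht : 0 < t) {ν μ : ℝ} (hν : 0 ≤ ν) (hνμ : ν ≤ μ) (hμ : μ ≤ 2) {x : ι → ℝ}
    (hx : x ∈ E.Hdot ν) :
    ‖V.error k t x‖ ≤ 2 * (21 * C + 6) * (h ^ μ + k ^ (μ / 2)) * t ^ (-((μ - ν) / 2))
      * E.hnorm ν x := by
  set c := 21 * C + 6 with hc
  set δ := h ^ 2 + k with hδ
  have hc0 : 0 < c := by positivity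
  have hδ0 : 0 < δ := by positivity
  have hCh : 0 ≤ C * h ^ 2 := by positivity
  set θ := ν / 2 with hθ
  set α := (μ - ν) / (2 - ν) with hα
  have hα0 : 0 ≤ α := div_nonneg (by linarith) (by linarith)
  have hα1 : α ≤ 1 := div_le_one_of_le₀ (by linarith) (by linarith)
  have hαθ : α * (1 - θ) = (μ - ν) / 2 := by
    -- For `ν = 2` the quotient defining `α` is `0 / 0 = 0`; this is harmless since then `1 - θ =
    -- 0`.
    rcases eq_or_ne ν 2 with h2 | h2
    · have h3 : μ = 2 := by linarith
      rw [hα, h2, h3]; simp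
    · have h3 : 2 - ν ≠ 0 := sub_ne_zero.2 h2.symm
      rw [hα, hθ]; field_simp
  have h₀ : ∀ x ∈ E.Hdot 0, ‖V.error k t x‖ ≤ c * (δ / t) ^ α * E.hnorm 0 x := by
    intro x hx
    rcases le_total 1 (δ / t) with h1 | h1
    · refine (V.norm_error_le_two hk.le ht hx).trans
        (mul_le_mul_of_nonneg_right ?_ (E.hnorm_nonneg _ _))
      have := Real.one_le_rpow h1 hα0
      nlinarith
    · refine (V.norm_error_le_of_nonsmooth hCh hV hk ht hx).trans
        (mul_le_mul_of_nonneg_right ?_ (E.hnorm_nonneg _ _))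
      have h3 : δ / t ≤ (δ / t) ^ α := by
        simpa using Real.rpow_le_rpow_of_exponent_ge (by positivity) h1 hα1
      refine le_trans ?_ (mul_le_mul_of_nonneg_left h3 hc0.le)
      rw [← mul_div_assoc]
      gcongr
      nlinarith [mul_nonneg hC hk.le, sq_nonneg h]
  have h₁ : ∀ x ∈ E.Hdot 2, ‖V.error k t x‖ ≤ c * δ * E.hnorm 2 x := by
    intro x hx
    refine (V.norm_error_le_of_smooth hCh hV hk ht hx).trans
      (mul_le_mul_of_nonneg_right ?_ (E.hnorm_nonneg _ _))
    nlinarith [mul_nonneg hC hk.le, sq_nonneg h]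
  have hr : (1 - θ) * 0 + θ * 2 = ν := by rw [hθ]; ring
  have hmain := E.norm_le_of_interpolation (Φ := V.error k t) (r₀ := 0) (r₁ := 2) (θ := θ)
    (by norm_num) (by positivity) (by positivity) (by linarith) (by linarith)
    (fun x hx y hy => V.error_add ht (E.Hdot_antitone (by norm_num) hx)
      (E.Hdot_antitone (by norm_num) hy)) h₀ h₁ (x := x) (by rwa [hr])
  rw [hr] at hmain
  refine hmain.trans (mul_le_mul_of_nonneg_right ?_ (E.hnorm_nonneg _ _))
  have e : (c * (δ / t) ^ α) ^ (1 - θ) * (c * δ) ^ θ = c * δ ^ (μ / 2) * t ^ (-((μ - ν) / 2)) := by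
    rw [Real.mul_rpow hc0.le (by positivity), Real.mul_rpow hc0.le hδ0.le,
      ← Real.rpow_mul (by positivity), hαθ, Real.div_rpow hδ0.le ht.le, Real.rpow_neg ht.le]
    have e1 : c ^ (1 - θ) * c ^ θ = c := by
      rw [← Real.rpow_add hc0, sub_add_cancel, Real.rpow_one]
    have e2 : δ ^ ((μ - ν) / 2) * δ ^ θ = δ ^ (μ / 2) := by
      rw [← Real.rpow_add hδ0]; congr 1; rw [hθ]; ring
    calc _ = (c ^ (1 - θ) * c ^ θ) * (δ ^ ((μ - ν) / 2) * δ ^ θ) * (t ^ ((μ - ν) / 2))⁻¹ := by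
          ring
      _ = _ := by rw [e1, e2]
  rw [e]
  have := add_rpow_le_rpow_add_rpow_half hh hk (hν.trans hνμ) hμ
  calc 2 * (c * δ ^ (μ / 2) * t ^ (-((μ - ν) / 2)))
      = 2 * c * δ ^ (μ / 2) * t ^ (-((μ - ν) / 2)) := by ring
    _ ≤ _ := by gcongr

/-- Interpolation of the bound `2 * √(1 / t)` on `Ḣ^{-1}` with the bound `2` on `H`; the weight `1 -
ρ` sits on `H`. -/
theorem GalerkinSpace.norm_error_le_stable (hk : 0 < k) (ht : 0 < t) {ρ : ℝ} (h0 : 0 ≤ ρ)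
    (h1 : ρ ≤ 1) {x : ι → ℝ} (hx : x ∈ E.Hdot (-ρ)) :
    ‖V.error k t x‖ ≤ 4 * t ^ (-(ρ / 2)) * E.hnorm (-ρ) x := by
  have hr : (1 - (1 - ρ)) * (-1) + (1 - ρ) * 0 = -ρ := by ring
  have hmain := E.norm_le_of_interpolation (Φ := V.error k t) (r₀ := -1) (r₁ := 0) (θ := 1 - ρ)
    (by norm_num) (by positivity) two_pos (by linarith) (by linarith)
    (fun x hx y hy => V.error_add ht hx hy)
    (fun x hx => V.norm_error_le_neg_one hk ht hx) (fun x hx => V.norm_error_le_two hk.le ht hx)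
    (x := x) (by rwa [hr])
  rw [hr] at hmain
  refine hmain.trans_eq ?_
  have e : √(1 / t) ^ ρ = t ^ (-(ρ / 2)) := by
    rw [Real.sqrt_eq_rpow, one_div, ← Real.rpow_neg_one, ← Real.rpow_mul ht.le,
      ← Real.rpow_mul ht.le]
    congr 1
    ring
  have e1 : (2 : ℝ) ^ ρ * 2 ^ (1 - ρ) = 2 := by
    rw [← Real.rpow_add two_pos, add_sub_cancel, Real.rpow_one]
  rw [sub_sub_cancel, Real.mul_rpow two_pos.le (Real.sqrt_nonneg _), e]
  linear_combination (2 * t ^ (-(ρ / 2)) * E.hnorm (-ρ) x) * e1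

/-- Both endpoints carry `1 / t`, with `√δ` on `Ḣ^{-1}` (approximation of order one) and `δ` on `H`
(order two), so only the power of `δ` is interpolated: `ρ / 2 + (1 - ρ) = (2 - ρ) / 2`. -/
theorem GalerkinSpace.norm_error_le_rough_interpolated (hC : 0 ≤ C) (hh : 0 < h) (hk : 0 < k)
    (hV₁ : ∀ x ∈ E.Hdot 1, ‖(V.ritz x : H) - E.toH x‖ ≤ C * h * E.hnorm 1 x)
    (hV₂ : ∀ x ∈ E.Hdot 2, ‖(V.ritz x : H) - E.toH x‖ ≤ C * h ^ 2 * E.hnorm 2 x)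
    (ht : 0 < t) {ρ : ℝ} (h0 : 0 ≤ ρ) (h1 : ρ ≤ 1) {x : ι → ℝ} (hx : x ∈ E.Hdot (-ρ)) :
    ‖V.error k t x‖ ≤ 2 * (21 * C + 6) * (h ^ (2 - ρ) + k ^ ((2 - ρ) / 2)) * t ^ (-1 : ℝ)
      * E.hnorm (-ρ) x := by
  set c := 21 * C + 6 with hc
  set δ := h ^ 2 + k with hδ
  have hc0 : 0 < c := by positivity
  have hδ0 : 0 < δ := by positivity
  have h₀ : ∀ x ∈ E.Hdot (-1), ‖V.error k t x‖ ≤ c / t * √δ * E.hnorm (-1) x := by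
    intro x hx
    refine (V.norm_error_le_of_rough (by positivity) hV₁ hk ht hx).trans
      (mul_le_mul_of_nonneg_right ?_ (E.hnorm_nonneg _ _))
    have a1 : h ≤ √δ := Real.le_sqrt_of_sq_le (by linarith)
    have a2 : √k ≤ √δ := Real.sqrt_le_sqrt (by nlinarith [sq_nonneg h])
    rw [div_mul_eq_mul_div]
    gcongr
    nlinarith
  have h₁ : ∀ x ∈ E.Hdot 0, ‖V.error k t x‖ ≤ c / t * δ * E.hnorm 0 x := by
    intro x hx
    refine (V.norm_error_le_of_nonsmooth (by positivity) hV₂ hk ht hx).trans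
      (mul_le_mul_of_nonneg_right ?_ (E.hnorm_nonneg _ _))
    rw [div_mul_eq_mul_div]
    gcongr
    nlinarith [mul_nonneg hC hk.le, sq_nonneg h]
  have hr : (1 - (1 - ρ)) * (-1) + (1 - ρ) * 0 = -ρ := by ring
  have hmain := E.norm_le_of_interpolation (Φ := V.error k t) (r₀ := -1) (r₁ := 0) (θ := 1 - ρ)
    (by norm_num) (by positivity) (by positivity) (by linarith) (by linarith)
    (fun x hx y hy => V.error_add ht hx hy) h₀ h₁ (x := x) (by rwa [hr])
  rw [hr] at hmain
  refine hmain.trans (mul_le_mul_of_nonneg_right ?_ (E.hnorm_nonneg _ _))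
  have e : (c / t * √δ) ^ (1 - (1 - ρ)) * (c / t * δ) ^ (1 - ρ)
      = c * δ ^ ((2 - ρ) / 2) * t ^ (-1 : ℝ) := by
    have hct : 0 < c / t := by positivity
    rw [sub_sub_cancel, Real.mul_rpow hct.le (Real.sqrt_nonneg _), Real.mul_rpow hct.le hδ0.le,
      Real.sqrt_eq_rpow, ← Real.rpow_mul hδ0.le, Real.rpow_neg_one]
    have e1 : (c / t) ^ ρ * (c / t) ^ (1 - ρ) = c / t := by
      rw [← Real.rpow_add hct, add_sub_cancel, Real.rpow_one]
    have e2 : δ ^ (1 / 2 * ρ) * δ ^ (1 - ρ) = δ ^ ((2 - ρ) / 2) := by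
      rw [← Real.rpow_add hδ0]; congr 1; ring
    calc _ = ((c / t) ^ ρ * (c / t) ^ (1 - ρ)) * (δ ^ (1 / 2 * ρ) * δ ^ (1 - ρ)) := by ring
      _ = _ := by rw [e1, e2]; ring
  rw [e]
  have := add_rpow_le_rpow_add_rpow_half hh hk (μ := 2 - ρ) (by linarith) (by linarith)
  calc 2 * (c * δ ^ ((2 - ρ) / 2) * t ^ (-1 : ℝ))
      = 2 * c * δ ^ ((2 - ρ) / 2) * t ^ (-1 : ℝ) := by ring
    _ ≤ _ := by gcongr

end Main

end Galerkin

theorem mainTheorem5 {H : Type*} [NormedAddCommGroup H] [InnerProductSpace ℝ H]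
    [CompleteSpace H] [TopologicalSpace.SeparableSpace H] (A : Galerkin.EllipticOperator H)
    {ι : Type*} (E : Galerkin.Eigensystem A ι)
    (V : Set.Ioc (0 : ℝ) 1 → Galerkin.GalerkinSpace E)
    (hV : Galerkin.ApproximationProperty V) :
    (∀ ν μ : ℝ, 0 ≤ ν → ν ≤ μ → μ ≤ 2 →
      ∃ C : ℝ, ∀ x ∈ E.Hdot ν, ∀ t : ℝ, 0 < t → ∀ h k : Set.Ioc (0 : ℝ) 1,
        ‖(V h).error k t x‖ ≤
          C * ((h : ℝ) ^ μ + (k : ℝ) ^ (μ / 2)) * t ^ (-((μ - ν) / 2)) * E.hnorm ν x) ∧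
    (∀ ρ : ℝ, 0 ≤ ρ → ρ ≤ 1 →
      ∃ C : ℝ, ∀ x ∈ E.Hdot (-ρ), ∀ t : ℝ, 0 < t → ∀ h k : Set.Ioc (0 : ℝ) 1,
        ‖(V h).error k t x‖ ≤ C * t ^ (-(ρ / 2)) * E.hnorm (-ρ) x) ∧
    (∀ ρ : ℝ, 0 ≤ ρ → ρ ≤ 1 →
      ∃ C : ℝ, ∀ x ∈ E.Hdot (-ρ), ∀ t : ℝ, 0 < t → ∀ h k : Set.Ioc (0 : ℝ) 1,
        ‖(V h).error k t x‖ ≤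
          C * ((h : ℝ) ^ (2 - ρ) + (k : ℝ) ^ ((2 - ρ) / 2)) * t ^ (-1 : ℝ) *
            E.hnorm (-ρ) x) := by
  obtain ⟨C, hC, hCV⟩ := hV.exists_nonneg
  refine ⟨fun ν μ hν hνμ hμ => ⟨2 * (21 * C + 6), fun x hx t ht h k => ?_⟩,
    fun ρ h0 h1 => ⟨4, fun x hx t ht h k => ?_⟩,
    fun ρ h0 h1 => ⟨2 * (21 * C + 6), fun x hx t ht h k => ?_⟩⟩
  · exact (V h).norm_error_le_interpolated hC h.2.1 k.2.1 (hCV h).2 ht hν hνμ hμ hx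
  · exact (V h).norm_error_le_stable k.2.1 ht h0 h1 hx
  · exact (V h).norm_error_le_rough_interpolated hC h.2.1 k.2.1 (hCV h).1 (hCV h).2 ht h0 h1 hx
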